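/- For each $n\ge 1$ let $N_{n,1},\dots,N_{n,n}$ be independent simple point processes on $\mathbb R$ (request processes of contents $1,\dots,n$), defined on a common probability space, each stationary and ergodic with intensity $\lambda_{n,i}\in(0,\infty)$. Let $\mathbb P^0_{n,i}$ be the Palm probability associated with $N_{n,i}$ (under which content $i$ is requested at time $0$), $G_{n,i}(t)=\mathbb P^0_{n,i}[N_{n,i}((0,t])\ge 1]$ the cdf of the inter-request time of content $i$, and $G^*_{n,i}(t)=G_{n,i}(t/\lambda_{n,i})$. Assume that all $G_{n,i}$ are continuous and that there is a continuous cdf $\Psi$ with support in $[0,\infty)$ and mean $m_\Psi>0$ such that $1-G^*_{n,i}(t)\ge 1-\Psi(t)$ for all $t,n,i$. Let $p_{n,i}=\lambda_{n,i}/\sum_{j}\lambda_{n,j}$, and let $\bar P_n(k)$ be the sum of the $n-k$ smallest of the numbers $p_{n,1},\dots,p_{n,n}$ (zero if $k\ge n$). Let $Y_{n,i}(t)=1$ if content $i$ is requested during $[-t,0)$ and $Y_{n,i}(t)=0$ otherwise, and let $Y_n(t)=\sum_{i=1}^n Y_{n,i}(t)$. Let the cache sizes satisfy $C_n\in(0,n)$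 (for all large $n$) and $C_n\to\infty$. Put $\tau_n=\inf\{t: Y_n(t)\ge C_n\}$, and define the stationary hit probabilities of content $i$ in the LRU cache of size $C_n$ and in the TTL cache with timer $T$ by $$H^{\mathrm{LRU}}_{n,i}=\mathbb P^0_{n,i}[Y_{n,i}(\tau_n)=1],\qquad H^{\mathrm{TTL}}_{n,i}(T)=\mathbb P^0_{n,i}[Y_{n,i}(T)=1].$$ Let the characteristic time $T_n\ge 0$ be the solution of $\mathbb E[Y_n(T_n)]=C_n$. Suppose that: (C1) there is $\beta_1\in(0,m_\Psi)$ such that $C_n\le\beta_1 n$ for all large $n$; (R5) there is $M>0$ such that $|G^*_{n,i}(x)-G^*_{n,i}(y)|\le M|x-y|$ for all $x,y\in\mathbb R$ and all $1\le i\le n$; (P1) there are constants $\kappa_1\in(1/m_\Psi,1/\beta_1)$, $\kappa_2\in[0,1)$ and $\gamma\in(0,1)$ such that $\bar P_n(\lceil\kappa_1C_n\rceil)>\gamma\,\bar P_n(\lfloor\kappa_2C_n\rfloor)$ for all large $n$. Then, for all large $n$, the characteristic time $T_n$ exists and is unique, and $$\max_{1\le i\le n}\left|H^{\mathrm{LRU}}_{n,i}-H^{\mathrm{TTL}}_{n,i}(T_n)\right|=O\!\left(\left(\frac{\log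 C_n}{C_n}\right)^{1/4}\right)\quad\text{as } n\to\infty.$$ -/

import Mathlib

open MeasureTheory ProbabilityTheory Filter Set Topology Asymptotics
open scoped ENNReal NNReal

noncomputable section

namespace LRU

/-! ### Stationary ergodic simple point processes on the real line -/

/-- The configuration `μ` seen from time `s`: every point `x` is moved to `x - s`. -/
def shift (s : ℝ) (μ : Measure ℝ) : Measure ℝ := μ.map (fun x => x - s)

/-- `μ` is the counting measure of a locally finite set of points, each with multiplicity one. -/
def IsSimpleConfig (μ : Measure ℝ) : Prop :=
  ∃ S : Set ℝ, (∀ r : ℝ, (S ∩ Icc (-r) r).Finite) ∧ μ = Measure.count.restrict S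

/-- The intensity of a stationary point process: the mean number of points in `(0, 1]`. -/
def intensity {Ω : Type*} [MeasurableSpace Ω] (P : Measure Ω) (N : Ω → Measure ℝ) : ℝ≥0∞ :=
  ∫⁻ ω, N ω (Ioc 0 1) ∂P

/-- `N` is a stationary and ergodic simple point process with intensity in `(0, ∞)`. A point process
is a random counting measure, with the σ-algebra on `Measure ℝ` generated by the evaluations. -/
structure IsRequestProcess {Ω : Type*} [MeasurableSpace Ω] (P : Measure Ω)
    (N : Ω → Measure ℝ) : Prop where
  measurable : Measurable N
  simple : ∀ᵐ ω ∂P, IsSimpleConfig (N ω)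
  stationary : ∀ s : ℝ, P.map (fun ω => shift s (N ω)) = P.map N
  ergodic : ∀ A : Set (Measure ℝ), MeasurableSet A → (∀ s : ℝ, shift s ⁻¹' A = A) →
    P (N ⁻¹' A) = 0 ∨ P (N ⁻¹' A) = 1
  intensity_pos : 0 < intensity P N
  intensity_lt_top : intensity P N < ∞

/-- The Palm probability of the event `A`, associated with the `i`-th of the jointly stationary
point processes `N`: `(1 / λ_i) 𝔼[∑ 1_A(N seen from s)]`, the sum over the points `s ∈ (0, 1]` of
the `i`-th process. -/
def palmProb {Ω ι : Type*} [MeasurableSpace Ω] (P : Measure Ω) (N : ι → Ω → Measure ℝ) (i : ι)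
    (A : Set (ι → Measure ℝ)) : ℝ :=
  ((intensity P (N i))⁻¹ *
    ∫⁻ ω, ∫⁻ s in Ioc 0 1, A.indicator 1 (fun j => shift s (N j ω)) ∂(N i ω) ∂P).toReal

/-- The cdf of the inter-request time of content `i`: the Palm probability that the first point
after time `0` is at most `t`, that is, that there is a point in `(0, t]`. -/
def interCdf {Ω ι : Type*} [MeasurableSpace Ω] (P : Measure Ω) (N : ι → Ω → Measure ℝ) (i : ι)
    (t : ℝ) : ℝ :=
  palmProb P N i {μ | μ i (Ioc 0 t) ≠ 0}

/-- The request rate `λ_i` as a real number. -/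
def rate {Ω ι : Type*} [MeasurableSpace Ω] (P : Measure Ω) (N : ι → Ω → Measure ℝ) (i : ι) : ℝ :=
  (intensity P (N i)).toReal

/-- The inter-request cdf rescaled to unit mean. -/
def interCdfStd {Ω ι : Type*} [MeasurableSpace Ω] (P : Measure Ω) (N : ι → Ω → Measure ℝ) (i : ι)
    (t : ℝ) : ℝ :=
  interCdf P N i (t / rate P N i)

/-! ### Popularity -/

/-- The popularity `p_i = λ_i / ∑_j λ_j` of content `i`. -/
def popularity {Ω : Type*} [MeasurableSpace Ω] (P : Measure Ω) {n : ℕ} (N : Fin n → Ω → Measure ℝ)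
    (i : Fin n) : ℝ :=
  rate P N i / ∑ j, rate P N j

/-- The sum of all but the `k` largest entries of `p`. The permutation `Tuple.sort (-p)` lists the
entries of `p` in decreasing order; position `j : Fin n` is the `(j + 1)`-st largest. -/
def tailSum {n : ℕ} (p : Fin n → ℝ) (k : ℕ) : ℝ :=
  ∑ j : Fin n, if k ≤ (j : ℕ) then p (Tuple.sort (fun i => -p i) j) else 0

/-! ### LRU and TTL caches -/

/-- The past time window `[-t, 0)`, which is `(-∞, 0)` for `t = ∞`. -/
def pastWindow (t : EReal) : Set ℝ := {x : ℝ | -t ≤ (x : EReal) ∧ x < 0}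

open Classical in
/-- `1` if there is a request in `[-t, 0)` and `0` otherwise. -/
def requested (μ : Measure ℝ) (t : EReal) : ℕ := if μ (pastWindow t) ≠ 0 then 1 else 0

/-- The number of distinct contents requested during `[-t, 0)`. -/
def numRequested {n : ℕ} (μ : Fin n → Measure ℝ) (t : EReal) : ℕ := ∑ i, requested (μ i) t

/-- The length of the smallest past interval in which `c` distinct contents are requested
(`∞` if there is none). -/
def evictionTime {n : ℕ} (c : ℝ) (μ : Fin n → Measure ℝ) : EReal :=
  sInf {t : EReal | c ≤ (numRequested μ t : ℝ)}

/-- The stationary hit probability of content `i` in an LRU cache of size `c`. -/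
def hitLRU {Ω : Type*} [MeasurableSpace Ω] (P : Measure Ω) {n : ℕ} (N : Fin n → Ω → Measure ℝ)
    (c : ℝ) (i : Fin n) : ℝ :=
  palmProb P N i {μ | requested (μ i) (evictionTime c μ) = 1}

/-- The stationary hit probability of content `i` in a TTL cache with timer `T`. -/
def hitTTL {Ω : Type*} [MeasurableSpace Ω] (P : Measure Ω) {n : ℕ} (N : Fin n → Ω → Measure ℝ)
    (T : ℝ) (i : Fin n) : ℝ :=
  palmProb P N i {μ | requested (μ i) (T : EReal) = 1}

/-- The expected number of contents in a stationary TTL cache with timer `T`. -/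
def expectedContents {Ω : Type*} [MeasurableSpace Ω] (P : Measure Ω) {n : ℕ}
    (N : Fin n → Ω → Measure ℝ) (T : ℝ) : ℝ :=
  ∫ ω, (numRequested (fun i => N i ω) (T : EReal) : ℝ) ∂P

/-- `T` is the characteristic time of an LRU cache of size `c`. -/
def IsCharTime {Ω : Type*} [MeasurableSpace Ω] (P : Measure Ω) {n : ℕ}
    (N : Fin n → Ω → Measure ℝ) (c T : ℝ) : Prop :=
  0 ≤ T ∧ expectedContents P N T = c

end LRU

end

namespace LRU

/-! ### Deterministic estimates for simple configurations -/

/-! Write F_j(t) for the probability that content j is requested in a window of length t, and K for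
the sum of the F_j, so that K(T_n) = C_n. The eviction time is where a sum of independent indicators
with mean K crosses the level C_n. It therefore concentrates near T_n once K is known to cross C_n
steeply.

Inversion. Palm calculus gives F_j' = λ_j (1 - G_j) (`isHitProfile`), and the TTL hit probability at
T is G_i(T) (`hitTTL_eq_interCdf`). Palm probabilities are handled by cutting (0, 1] into m cells.
In each cell at most about one point, the first or the last, can lack a neighbour on the far side of
the cell, so counting points reduces to probabilities of gaps, which are increments of F_j. For the
LRU event, what the other contents do is bounded through a window fixed by the cell. That bound is
independent of content i, and expectations factorise.

Steepness (`growth_lower_bound`). Contents with λ_j T_n ≥ L each have F_j(T_n) > 1/κ₁, so at most κ₁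
C_n of them exist. By (P1) the remaining contents carry a fixed fraction of the tail mass beyond the
⌊κ₂ C_n⌋ most popular ones, and K(T_n) = C_n forces that mass times T_n Σ λ_j to be at least (1 -
κ₂) C_n. For these contents 1 - G_j stays bounded below slightly past T_n, so T_n K' ≥ g C_n up to a
multiple of T_n exceeding one. This also gives uniqueness of T_n.

Error (`abs_hitLRU_sub_hitTTL_le`). Take δ of order sqrt(log C_n / C_n). Over [T_n, (1 + δ) T_n] and
[(1 - δ) T_n, T_n], K moves by at least δ g C_n, so Chernoff bounds make the eviction time leave a
δ-neighbourhood of T_n with probability at most 1 / C_n. The resulting change of G_i is at most of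
order M λ_i T_n δ by (R5), and at most of order 1 / (λ_i T_n) by Markov's inequality. Multiplying
the two removes the rate and leaves sqrt(δ), which is the exponent 1/4. -/

theorem shift_apply (s : ℝ) (μ : Measure ℝ) {B : Set ℝ} (hB : MeasurableSet B) :
    shift s μ B = μ ((fun x => x - s) ⁻¹' B) :=
  Measure.map_apply (by fun_prop) hB

theorem pastWindow_coe (t : ℝ) : pastWindow (t : EReal) = Ico (-t) 0 := by
  ext x
  simp only [pastWindow, mem_ofPred_eq, mem_Ico, ← EReal.coe_neg, EReal.coe_le_coe_iff]

theorem shift_pastWindow (s t : ℝ) (μ : Measure ℝ) :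
    shift s μ (pastWindow (t : EReal)) = μ (Ico (s - t) s) := by
  rw [pastWindow_coe, shift_apply _ _ measurableSet_Ico, preimage_sub_const_Ico]
  congr 2 <;> ring

theorem shift_Ioc_zero (s t : ℝ) (μ : Measure ℝ) :
    shift s μ (Ioc 0 t) = μ (Ioc s (s + t)) := by
  rw [shift_apply _ _ measurableSet_Ioc, preimage_sub_const_Ioc]
  congr 2 <;> ring

/-- On a bounded interval, integration against a simple configuration is a finite sum. -/
theorem IsSimpleConfig.exists_finset {μ : Measure ℝ} (hμ : IsSimpleConfig μ) :
    ∃ S : Set ℝ, (∀ B, MeasurableSet B → (μ B = 0 ↔ ∀ x ∈ B, x ∉ S)) ∧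
      ∀ a b : ℝ, ∃ K : Finset ℝ, (∀ x, x ∈ K ↔ x ∈ S ∧ x ∈ Ioc a b) ∧
        (∀ f : ℝ → ℝ≥0∞, ∫⁻ s in Ioc a b, f s ∂μ = ∑ s ∈ K, f s) := by
  obtain ⟨S, hS, rfl⟩ := hμ
  refine ⟨S, fun B hB => ?_, fun a b => ?_⟩
  · rw [Measure.restrict_apply hB, Measure.count_eq_zero_iff, eq_empty_iff_forall_notMem]
    simp
  · have hfin : (S ∩ Ioc a b).Finite := by
      refine (hS (max |a| |b|)).subset fun x hx => ⟨hx.1, ?_, ?_⟩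
      · have := neg_abs_le a
        have := le_max_left |a| |b|
        linarith [hx.2.1]
      · exact hx.2.2.trans ((le_abs_self b).trans (le_max_right _ _))
    refine ⟨hfin.toFinset, by simp, fun f => ?_⟩
    rw [Measure.restrict_restrict measurableSet_Ioc, inter_comm]
    conv_lhs => rw [← hfin.coe_toFinset]
    rw [lintegral_finset]
    simp

section
variable {μ : Measure ℝ}

/-- If some point of the interval fails `A`, the number of points in `A` is at most all but one. -/
theorem IsSimpleConfig.lintegral_add_indicator_le (hμ : IsSimpleConfig μ) (a b : ℝ)
    (A : Set ℝ) (U : Prop) [Decidable U]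
    (h : U → ∀ S : Set ℝ, (∀ B, MeasurableSet B → (μ B = 0 ↔ ∀ x ∈ B, x ∉ S)) →
      ∀ K : Finset ℝ, (∀ x, x ∈ K ↔ x ∈ S ∧ x ∈ Ioc a b) → ∃ s ∈ K, s ∉ A) :
    ∫⁻ s in Ioc a b, A.indicator 1 s ∂μ + (if U then 1 else 0) ≤ μ (Ioc a b) := by
  obtain ⟨S, hS, hK⟩ := hμ.exists_finset
  obtain ⟨K, hKm, hKf⟩ := hK a b
  have hμK : μ (Ioc a b) = ∑ s ∈ K, 1 := by
    rw [← hKf, lintegral_const, one_mul, Measure.restrict_apply_univ]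
  rw [hKf, hμK]
  by_cases hU : U
  · obtain ⟨s, hs, hsA⟩ := h hU S hS K hKm
    rw [if_pos hU, ← Finset.sum_erase_add K _ hs, ← Finset.sum_erase_add K (fun _ => (1 : ℝ≥0∞)) hs,
      indicator_of_notMem hsA, add_zero]
    gcongr
    exact indicator_le_self' (fun _ _ => zero_le) _
  · rw [if_neg hU, add_zero]
    gcongr
    exact indicator_le_self' (fun _ _ => zero_le) _

/-- If at most one point of the interval fails `A`, and none unless `U` holds, then the number
of points in `A` is at least all but one. -/
theorem IsSimpleConfig.le_lintegral_add_indicator (hμ : IsSimpleConfig μ) (a b : ℝ)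
    (A : Set ℝ) (U : Prop) [Decidable U]
    (h : ∀ S : Set ℝ, (∀ B, MeasurableSet B → (μ B = 0 ↔ ∀ x ∈ B, x ∉ S)) →
      (∀ s ∈ S, s ∈ Ioc a b → s ∉ A → U) ∧
      (∀ s ∈ S, ∀ s' ∈ S, s ∈ Ioc a b → s' ∈ Ioc a b → s ∉ A → s' ∉ A → s = s')) :
    μ (Ioc a b) ≤ ∫⁻ s in Ioc a b, A.indicator 1 s ∂μ + (if U then 1 else 0) := by
  obtain ⟨S, hS, hK⟩ := hμ.exists_finset
  obtain ⟨K, hKm, hKf⟩ := hK a b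
  have hμK : μ (Ioc a b) = ∑ s ∈ K, 1 := by
    rw [← hKf, lintegral_const, one_mul, Measure.restrict_apply_univ]
  rw [hKf, hμK]
  obtain ⟨h1, h2⟩ := h S hS
  by_cases hex : ∃ s ∈ K, s ∉ A
  · obtain ⟨s, hs, hsA⟩ := hex
    have hs' := (hKm s).1 hs
    rw [if_pos (h1 s hs'.1 hs'.2 hsA), ← Finset.sum_erase_add K _ hs,
      ← Finset.sum_erase_add K (A.indicator 1) hs, indicator_of_notMem hsA, add_zero]
    gcongr with x hx
    have hx' := (hKm x).1 (Finset.mem_of_mem_erase hx)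
    have hxA : x ∈ A := by
      by_contra hxA
      exact Finset.ne_of_mem_erase hx (h2 x hx'.1 s hs'.1 hx'.2 hs'.2 hxA hsA)
    simp [hxA]
  · push Not at hex
    refine le_add_right (Finset.sum_le_sum fun s hs => ?_)
    simp [hex s hs]

open Classical in
-- When the gap beyond a nonempty cell is empty, the last point of the cell has no successor within
-- `t`.
theorem IsSimpleConfig.count_succ_le (hμ : IsSimpleConfig μ) (a h t : ℝ) :
    ∫⁻ s in Ioc a (a + h), {s | μ (Ioc s (s + t)) ≠ 0}.indicator 1 s ∂μ +
      (if μ (Ioc a (a + h)) ≠ 0 ∧ μ (Ioc (a + h) (a + h + t)) = 0 then 1 else 0) ≤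
      μ (Ioc a (a + h)) := by
  refine hμ.lintegral_add_indicator_le _ _ _ _ ?_
  rintro ⟨hU1, hU2⟩ S hS K hK
  have hne : K.Nonempty := by
    by_contra hne
    rw [Finset.not_nonempty_iff_eq_empty] at hne
    refine hU1 ((hS _ measurableSet_Ioc).2 fun x hx hxS => ?_)
    simpa [hne] using (hK x).2 ⟨hxS, hx⟩
  refine ⟨K.max' hne, K.max'_mem hne, ?_⟩
  have hmem := (hK _).1 (K.max'_mem hne)
  simp only [mem_ofPred_eq, ne_eq, not_not]
  refine (hS _ measurableSet_Ioc).2 fun x hx hxS => ?_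
  by_cases hxb : x ≤ a + h
  · exact absurd (K.le_max' x ((hK x).2 ⟨hxS, hmem.2.1.trans hx.1, hxb⟩)) (not_le.2 hx.1)
  · exact (hS _ measurableSet_Ioc).1 hU2 x
      ⟨not_le.1 hxb, hx.2.trans (by linarith [hmem.2.2])⟩ hxS

open Classical in
-- A point with no successor within `t + h` must be the last one of its cell, and its empty window
-- covers the gap of length `t` beyond the cell. The extra `h` pays for the position of the point
-- inside the cell.
theorem IsSimpleConfig.le_count_succ (hμ : IsSimpleConfig μ) (a h t : ℝ) (ht : 0 ≤ t) :
    μ (Ioc a (a + h)) ≤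
    ∫⁻ s in Ioc a (a + h), {s | μ (Ioc s (s + (t + h))) ≠ 0}.indicator 1 s ∂μ +
      (if μ (Ioc a (a + h)) ≠ 0 ∧ μ (Ioc (a + h) (a + h + t)) = 0 then 1 else 0) := by
  refine hμ.le_lintegral_add_indicator _ _ _ _ fun S hS => ⟨?_, ?_⟩
  · intro s hsS hs hsA
    simp only [mem_ofPred_eq, ne_eq, not_not] at hsA
    refine ⟨fun h0 => (hS _ measurableSet_Ioc).1 h0 s hs hsS, ?_⟩
    refine measure_mono_null (Ioc_subset_Ioc hs.2 ?_) hsA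
    linarith [hs.1]
  · intro s hsS s' hs'S hs hs' hsA hs'A
    simp only [mem_ofPred_eq, ne_eq, not_not] at hsA hs'A
    rcases lt_trichotomy s s' with hlt | heq | hlt
    · exact absurd hs'S ((hS _ measurableSet_Ioc).1 hsA s' ⟨hlt, by linarith [hs'.2, hs.1]⟩)
    · exact heq
    · exact absurd hsS ((hS _ measurableSet_Ioc).1 hs'A s ⟨hlt, by linarith [hs.2, hs'.1]⟩)

open Classical in
-- Mirror image of `count_succ_le`, with the first point of the cell. The gap includes `a`, which is
-- outside the cell but may precede its first point.
theorem IsSimpleConfig.count_pred_le (hμ : IsSimpleConfig μ) (a h t : ℝ) :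
    ∫⁻ s in Ioc a (a + h), {s | μ (Ico (s - t) s) ≠ 0}.indicator 1 s ∂μ +
      (if μ (Ioc a (a + h)) ≠ 0 ∧ μ (Icc (a - t) a) = 0 then 1 else 0) ≤
      μ (Ioc a (a + h)) := by
  refine hμ.lintegral_add_indicator_le _ _ _ _ ?_
  rintro ⟨hU1, hU2⟩ S hS K hK
  have hne : K.Nonempty := by
    by_contra hne
    rw [Finset.not_nonempty_iff_eq_empty] at hne
    refine hU1 ((hS _ measurableSet_Ioc).2 fun x hx hxS => ?_)
    simpa [hne] using (hK x).2 ⟨hxS, hx⟩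
  refine ⟨K.min' hne, K.min'_mem hne, ?_⟩
  have hmem := (hK _).1 (K.min'_mem hne)
  simp only [mem_ofPred_eq, ne_eq, not_not]
  refine (hS _ measurableSet_Ico).2 fun x hx hxS => ?_
  by_cases hxa : a < x
  · exact absurd (K.min'_le x ((hK x).2 ⟨hxS, hxa, hx.2.le.trans hmem.2.2⟩)) (not_le.2 hx.2)
  · exact (hS _ measurableSet_Icc).1 hU2 x
      ⟨by linarith [hmem.2.1, hx.1], not_lt.1 hxa⟩ hxS

open Classical in
theorem IsSimpleConfig.le_count_pred (hμ : IsSimpleConfig μ) (a h t : ℝ) (ht : 0 ≤ t) :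
    μ (Ioc a (a + h)) ≤
    ∫⁻ s in Ioc a (a + h), {s | μ (Ico (s - (t + h)) s) ≠ 0}.indicator 1 s ∂μ +
      (if μ (Ioc a (a + h)) ≠ 0 ∧ μ (Icc (a - t) a) = 0 then 1 else 0) := by
  refine hμ.le_lintegral_add_indicator _ _ _ _ fun S hS => ⟨?_, ?_⟩
  · intro s hsS hs hsA
    simp only [mem_ofPred_eq, ne_eq, not_not] at hsA
    refine ⟨fun h0 => (hS _ measurableSet_Ioc).1 h0 s hs hsS, ?_⟩
    have hsub : Icc (a - t) a ⊆ Ico (s - (t + h)) s := fun x hx =>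
      ⟨by linarith [hs.2, hx.1], hx.2.trans_lt hs.1⟩
    exact measure_mono_null hsub hsA
  · intro s hsS s' hs'S hs hs' hsA hs'A
    simp only [mem_ofPred_eq, ne_eq, not_not] at hsA hs'A
    rcases lt_trichotomy s s' with hlt | heq | hlt
    · exact absurd hsS ((hS _ measurableSet_Ico).1 hs'A s ⟨by linarith [hs'.2, hs.1], hlt⟩)
    · exact heq
    · exact absurd hs'S ((hS _ measurableSet_Ico).1 hsA s' ⟨by linarith [hs.2, hs'.1], hlt⟩)

/-- Decomposition of an integral over `(0, 1]` into the cells of the grid of mesh `1 / m`. -/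
theorem lintegral_Ioc_eq_sum_grid (μ : Measure ℝ) (f : ℝ → ℝ≥0∞) {m : ℕ} (hm : 0 < m) :
    ∫⁻ s in Ioc 0 1, f s ∂μ =
      ∑ k ∈ Finset.range m, ∫⁻ s in Ioc ((k : ℝ) / m) ((k : ℝ) / m + 1 / m), f s ∂μ := by
  have hm' : (0 : ℝ) < m := by exact_mod_cast hm
  have key : ∀ K : ℕ, ∫⁻ s in Ioc 0 ((K : ℝ) / m), f s ∂μ =
      ∑ k ∈ Finset.range K, ∫⁻ s in Ioc ((k : ℝ) / m) ((k : ℝ) / m + 1 / m), f s ∂μ := by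
    intro K
    induction K with
    | zero => simp
    | succ K ih =>
      have h1 : (((K + 1 : ℕ) : ℝ)) / m = (K : ℝ) / m + 1 / m := by push_cast; ring
      rw [Finset.sum_range_succ, ← ih, h1, ← lintegral_union measurableSet_Ioc,
        Ioc_union_Ioc_eq_Ioc (by positivity) (by simp)]
      rw [Set.disjoint_left]
      intro x hx hx'
      exact absurd hx.2 (not_le.2 hx'.1)
  rw [← key m, div_self hm'.ne']

end

section window

variable {Ω : Type*} [MeasurableSpace Ω] {P : Measure Ω}

/-! ### Window probabilities of a stationary process -/

/-- The probability of at least one request in a window of length `t`. -/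
noncomputable def hitProb (P : Measure Ω) (N : Ω → Measure ℝ) (t : ℝ) : ℝ :=
  P.real {ω | N ω (Ico (-t) 0) ≠ 0}

theorem measurable_shift (s : ℝ) : Measurable (shift s) :=
  Measure.measurable_map _ (by fun_prop)

theorem hitProb_mono [IsProbabilityMeasure P] {N : Ω → Measure ℝ} {s t : ℝ} (h : s ≤ t) :
    hitProb P N s ≤ hitProb P N t :=
  measureReal_mono fun _ hω h0 => hω (measure_mono_null (Ico_subset_Ico_left (by linarith)) h0)

theorem hitProb_le_one [IsProbabilityMeasure P] (N : Ω → Measure ℝ) (t : ℝ) : hitProb P N t ≤ 1 :=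
  measureReal_le_one

theorem hitProb_zero (N : Ω → Measure ℝ) : hitProb P N 0 = 0 := by simp [hitProb]

section single
variable {N : Ω → Measure ℝ} (hN : IsRequestProcess P N)
include hN

theorem IsRequestProcess.measurable_eval {B : Set ℝ} (hB : MeasurableSet B) :
    Measurable fun ω => N ω B :=
  (Measure.measurable_coe hB).comp hN.measurable

theorem IsRequestProcess.measurableSet_ne {B : Set ℝ} (hB : MeasurableSet B) :
    MeasurableSet {ω | N ω B ≠ 0} :=
  (hN.measurable_eval hB (measurableSet_singleton 0)).compl

theorem IsRequestProcess.measurableSet_eq {B : Set ℝ} (hB : MeasurableSet B) :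
    MeasurableSet {ω | N ω B = 0} :=
  hN.measurable_eval hB (measurableSet_singleton 0)

theorem IsRequestProcess.lintegral_shift (s : ℝ) {f : Measure ℝ → ℝ≥0∞} (hf : Measurable f) :
    ∫⁻ ω, f (shift s (N ω)) ∂P = ∫⁻ ω, f (N ω) ∂P := by
  have hs : Measurable fun ω => shift s (N ω) := (measurable_shift s).comp hN.measurable
  rw [← lintegral_map hf hN.measurable, ← hN.stationary s, lintegral_map hf hs]

theorem IsRequestProcess.prob_shift (s : ℝ) {E : Set (Measure ℝ)} (hE : MeasurableSet E) :
    P {ω | shift s (N ω) ∈ E} = P {ω | N ω ∈ E} := by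
  have h := congrArg (fun ν => ν E) (hN.stationary s)
  have hs : Measurable fun ω => shift s (N ω) := (measurable_shift s).comp hN.measurable
  rwa [Measure.map_apply hs hE,
    Measure.map_apply hN.measurable hE] at h

theorem IsRequestProcess.rate_pos : 0 < (intensity P N).toReal :=
  ENNReal.toReal_pos hN.intensity_pos.ne' hN.intensity_lt_top.ne

/-- By stationarity all cells of length `1 / m` have the same mean count, and `m` of them tile `(0,
1]`. -/
theorem IsRequestProcess.lintegral_cell {m : ℕ} (hm : 0 < m) (a : ℝ) :
    ∫⁻ ω, N ω (Ioc a (a + 1 / m)) ∂P = ENNReal.ofReal ((intensity P N).toReal / m) := by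
  have hshift : ∀ b : ℝ, ∫⁻ ω, N ω (Ioc b (b + 1 / m)) ∂P =
      ∫⁻ ω, N ω (Ioc a (a + 1 / m)) ∂P := by
    intro b
    rw [← hN.lintegral_shift (a - b) (Measure.measurable_coe measurableSet_Ioc)]
    refine lintegral_congr fun ω => ?_
    rw [shift_apply _ _ measurableSet_Ioc, preimage_sub_const_Ioc]
    congr 2 <;> ring
  have hsum : intensity P N = m * ∫⁻ ω, N ω (Ioc a (a + 1 / m)) ∂P := by
    have h1 : ∀ ω, N ω (Ioc 0 1) =
        ∑ k ∈ Finset.range m, N ω (Ioc ((k : ℝ) / m) ((k : ℝ) / m + 1 / m)) := by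
      intro ω
      simpa using lintegral_Ioc_eq_sum_grid (N ω) (fun _ => 1) hm
    rw [intensity, lintegral_congr h1,
      lintegral_finsetSum _ fun k _ => hN.measurable_eval measurableSet_Ioc]
    rw [Finset.sum_congr rfl fun k _ => hshift _]
    simp
  have hm' : (0 : ℝ) < m := by exact_mod_cast hm
  rw [ENNReal.ofReal_div_of_pos hm', ENNReal.ofReal_toReal hN.intensity_lt_top.ne, hsum,
    ENNReal.ofReal_natCast, mul_comm, ENNReal.mul_div_cancel_right (by exact_mod_cast hm.ne')
    (ENNReal.natCast_ne_top m)]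

theorem IsRequestProcess.ae_singleton (x : ℝ) : ∀ᵐ ω ∂P, N ω {x} = 0 := by
  have hle : ∀ m : ℕ, ∫⁻ ω, N ω {x} ∂P ≤
      ENNReal.ofReal ((intensity P N).toReal / ((m : ℝ) + 1)) := by
    intro m
    have h := hN.lintegral_cell (Nat.succ_pos m) (x - 1 / ((m + 1 : ℕ) : ℝ))
    push_cast at h
    rw [← h]
    refine lintegral_mono fun ω => measure_mono ?_
    rw [singleton_subset_iff, sub_add_cancel]
    exact ⟨by linarith [show (0 : ℝ) < 1 / ((m : ℝ) + 1) by positivity], le_rfl⟩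
  have hlim : Tendsto (fun m : ℕ => ENNReal.ofReal ((intensity P N).toReal / ((m : ℝ) + 1)))
      atTop (𝓝 0) := by
    rw [← ENNReal.ofReal_zero]
    refine (ENNReal.continuous_ofReal.tendsto 0).comp ?_
    exact tendsto_const_nhds.div_atTop
      (tendsto_atTop_add_const_right _ _ tendsto_natCast_atTop_atTop)
  exact (lintegral_eq_zero_iff (hN.measurable_eval (measurableSet_singleton x))).1
    (le_antisymm (ge_of_tendsto' hlim hle) zero_le)

theorem IsRequestProcess.prob_Ico (a b : ℝ) :
    P.real {ω | N ω (Ico a b) ≠ 0} = hitProb P N (b - a) := by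
  have hE : MeasurableSet {μ : Measure ℝ | μ (Ico (-(b - a)) 0) ≠ 0} :=
    (Measure.measurable_coe measurableSet_Ico (measurableSet_singleton 0)).compl
  have h := hN.prob_shift b hE
  simp only [mem_ofPred_eq, shift_apply _ _ (measurableSet_Ico (a := -(b - a))),
    preimage_sub_const_Ico] at h
  rw [hitProb, measureReal_def, measureReal_def, ← h]
  ring_nf

theorem IsRequestProcess.ae_Ico_eq_Icc {a b : ℝ} (hab : a ≤ b) :
    ∀ᵐ ω ∂P, N ω (Ico a b) = N ω (Icc a b) := by
  filter_upwards [hN.ae_singleton b] with ω hω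
  refine le_antisymm (measure_mono Ico_subset_Icc_self) ?_
  rw [← Ico_union_right hab]
  exact (measure_union_le _ _).trans (by rw [hω, add_zero])

theorem IsRequestProcess.ae_Ioc_eq_Icc {a b : ℝ} (hab : a ≤ b) :
    ∀ᵐ ω ∂P, N ω (Ioc a b) = N ω (Icc a b) := by
  filter_upwards [hN.ae_singleton a] with ω hω
  refine le_antisymm (measure_mono Ioc_subset_Icc_self) ?_
  rw [← Ioc_union_left hab]
  exact (measure_union_le _ _).trans (by rw [hω, add_zero])

theorem IsRequestProcess.prob_Icc {a b : ℝ} (hab : a ≤ b) :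
    P.real {ω | N ω (Icc a b) ≠ 0} = hitProb P N (b - a) := by
  rw [← hN.prob_Ico]
  refine measureReal_congr ?_
  filter_upwards [hN.ae_Ico_eq_Icc hab] with ω hω
  exact congrArg (· ≠ 0) hω.symm

variable [IsProbabilityMeasure P]

/-- Up to endpoints, which almost surely carry no point, the gap event is the difference of two
nested window events, of lengths `t + h` and `t`. -/
theorem IsRequestProcess.prob_gap_right (a : ℝ) {h t : ℝ} (hh : 0 ≤ h) (ht : 0 ≤ t) :
    P.real {ω | N ω (Ioc a (a + h)) ≠ 0 ∧ N ω (Ioc (a + h) (a + h + t)) = 0} =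
      hitProb P N (t + h) - hitProb P N t := by
  have e1 := hN.prob_Icc (a := a) (b := a + h + t) (by linarith)
  have e2 := hN.prob_Icc (a := a + h) (b := a + h + t) (by linarith)
  rw [show a + h + t - a = t + h by ring] at e1
  rw [show a + h + t - (a + h) = t by ring] at e2
  rw [← e1, ← e2, ← measureReal_sdiff (ofPred_subset_ofPred.2 fun ω hω h0 =>
    hω (measure_mono_null (Icc_subset_Icc_left (by linarith)) h0)) (hN.measurableSet_ne measurableSet_Icc)]
  refine measureReal_congr ?_
  filter_upwards [hN.ae_Ioc_eq_Icc (a := a) (b := a + h) (by linarith),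
    hN.ae_Ioc_eq_Icc (a := a + h) (b := a + h + t) (by linarith)] with ω h1 h2
  refine propext ?_
  change (N ω _ ≠ 0 ∧ N ω _ = 0) ↔ (N ω _ ≠ 0 ∧ ¬ (N ω _ ≠ 0))
  rw [h1, h2, not_not, and_congr_left_iff]
  intro h0
  refine not_congr ⟨fun h3 => ?_, fun h3 => measure_mono_null (Icc_subset_Icc_right (by linarith)) h3⟩
  rw [← Icc_union_Icc_eq_Icc (b := a + h) (by linarith) (by linarith)]
  exact measure_union_null h3 h0

theorem IsRequestProcess.prob_gap_left (a : ℝ) {h t : ℝ} (hh : 0 ≤ h) (ht : 0 ≤ t) :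
    P.real {ω | N ω (Ioc a (a + h)) ≠ 0 ∧ N ω (Icc (a - t) a) = 0} =
      hitProb P N (t + h) - hitProb P N t := by
  have e1 := hN.prob_Icc (a := a - t) (b := a + h) (by linarith)
  have e2 := hN.prob_Icc (a := a - t) (b := a) (by linarith)
  rw [show a + h - (a - t) = t + h by ring] at e1
  rw [show a - (a - t) = t by ring] at e2
  rw [← e1, ← e2, ← measureReal_sdiff (ofPred_subset_ofPred.2 fun ω hω h0 =>
    hω (measure_mono_null (Icc_subset_Icc_right (by linarith)) h0)) (hN.measurableSet_ne measurableSet_Icc)]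
  refine measureReal_congr ?_
  filter_upwards [hN.ae_Ioc_eq_Icc (a := a) (b := a + h) (by linarith)] with ω h1
  refine propext ?_
  change (N ω _ ≠ 0 ∧ N ω _ = 0) ↔ (N ω _ ≠ 0 ∧ ¬ (N ω _ ≠ 0))
  rw [h1, not_not, and_congr_left_iff]
  intro h0
  refine not_congr ⟨fun h3 => ?_, fun h3 => measure_mono_null (Icc_subset_Icc_left (by linarith)) h3⟩
  rw [← Icc_union_Icc_eq_Icc (b := a) (by linarith) (by linarith)]
  exact measure_union_null h0 h3

/-- By ergodicity, a request process almost surely has a point, so the window probabilities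
tend to one. -/
theorem IsRequestProcess.tendsto_hitProb :
    Tendsto (fun k : ℕ => hitProb P N (2 * k)) atTop (𝓝 1) := by
  have hA : MeasurableSet {μ : Measure ℝ | μ univ = 0} :=
    Measure.measurable_coe MeasurableSet.univ (measurableSet_singleton 0)
  have h0 : P {ω | N ω univ = 0} = 0 := by
    rcases hN.ergodic _ hA (fun s => by
      ext μ
      simp only [mem_preimage, mem_ofPred_eq, shift_apply _ _ MeasurableSet.univ, preimage_univ]) with h | h
    · exact h
    · exfalso
      have hae : ∀ᵐ ω ∂P, N ω univ = 0 := (prob_compl_eq_zero_iff (hN.measurable hA)).2 h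
      refine hN.intensity_pos.ne' ((lintegral_eq_zero_iff (hN.measurable_eval measurableSet_Ioc)).2 ?_)
      filter_upwards [hae] with ω hω
      exact measure_mono_null (subset_univ _) hω
  have hmono : Monotone fun k : ℕ => {ω | N ω (Ico (-(k : ℝ)) k) ≠ 0} := by
    intro k l hkl ω hω h1
    have : (k : ℝ) ≤ l := by exact_mod_cast hkl
    exact hω (measure_mono_null (Ico_subset_Ico (by linarith) this) h1)
  have hU : (⋃ k : ℕ, {ω | N ω (Ico (-(k : ℝ)) k) ≠ 0}) = {ω | N ω univ = 0}ᶜ := by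
    ext ω
    simp only [mem_iUnion, mem_ofPred_eq, mem_compl_iff, ← not_forall]
    refine not_congr ⟨fun h => ?_, fun h k => measure_mono_null (subset_univ _) h⟩
    rw [← show (⋃ k : ℕ, Ico (-(k : ℝ)) k) = univ from ?_]
    · exact measure_iUnion_null h
    · refine eq_univ_of_forall fun x => mem_iUnion.2 ?_
      obtain ⟨k, hk⟩ := exists_nat_gt |x|
      exact ⟨k, by linarith [neg_abs_le x], (le_abs_self x).trans_lt hk⟩
  have hlim := tendsto_measure_iUnion_atTop (μ := P) hmono
  rw [hU, (prob_compl_eq_one_iff (hN.measurableSet_eq MeasurableSet.univ)).2 h0] at hlim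
  have := (ENNReal.tendsto_toReal ENNReal.one_ne_top).comp hlim
  refine this.congr fun k => ?_
  have := hN.prob_Ico (-(k : ℝ)) k
  rw [show (k : ℝ) - -k = 2 * k by ring] at this
  exact this

end single
end window

section palmBounds

variable {Ω : Type*} [MeasurableSpace Ω] {P : Measure Ω}

/-! ### Bounds for Palm probabilities -/

section palm
variable {ι : Type*} {N : ι → Ω → Measure ℝ} {i : ι}

theorem palm_lintegral_le (A : Set (ι → Measure ℝ)) :
    ∫⁻ ω, ∫⁻ s in Ioc 0 1, A.indicator 1 (fun j => shift s (N j ω)) ∂(N i ω) ∂P ≤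
      intensity P (N i) := by
  refine lintegral_mono fun ω => ?_
  calc ∫⁻ s in Ioc 0 1, A.indicator 1 (fun j => shift s (N j ω)) ∂(N i ω)
      ≤ ∫⁻ s in Ioc 0 1, 1 ∂(N i ω) :=
        lintegral_mono fun s => indicator_le_self' (fun _ _ => zero_le) _
    _ = N i ω (Ioc 0 1) := by simp

theorem palmProb_mono (hN : IsRequestProcess P (N i)) {A B : Set (ι → Measure ℝ)} (h : A ⊆ B) :
    palmProb P N i A ≤ palmProb P N i B := by
  refine ENNReal.toReal_mono ?_ ?_
  · exact ENNReal.mul_ne_top (ENNReal.inv_ne_top.2 hN.intensity_pos.ne')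
      ((palm_lintegral_le B).trans_lt hN.intensity_lt_top).ne
  · gcongr

theorem palmProb_nonneg (A : Set (ι → Measure ℝ)) : 0 ≤ palmProb P N i A := ENNReal.toReal_nonneg

theorem palmProb_le_one (hN : IsRequestProcess P (N i)) (A : Set (ι → Measure ℝ)) :
    palmProb P N i A ≤ 1 := by
  rw [palmProb, ENNReal.toReal_mul, ENNReal.toReal_inv, inv_mul_le_one₀ hN.rate_pos]
  exact ENNReal.toReal_mono hN.intensity_lt_top.ne (palm_lintegral_le A)

/-- The hypothesis is additive because subtraction in `ℝ≥0∞` truncates; finiteness of the intensity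
allows the passage to `ℝ`. -/
theorem palmProb_le_div (hN : IsRequestProcess P (N i)) {A : Set (ι → Measure ℝ)} {x y : ℝ}
    (hx : 0 ≤ x) (hy : 0 ≤ y)
    (h : ∫⁻ ω, ∫⁻ s in Ioc 0 1, A.indicator 1 (fun j => shift s (N j ω)) ∂(N i ω) ∂P +
      ENNReal.ofReal x ≤ ENNReal.ofReal y) :
    palmProb P N i A ≤ (y - x) / rate P N i := by
  have hfin := ((palm_lintegral_le (P := P) (N := N) (i := i) A).trans_lt hN.intensity_lt_top).ne
  have h2 := ENNReal.toReal_mono ENNReal.ofReal_ne_top h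
  rw [ENNReal.toReal_add hfin ENNReal.ofReal_ne_top, ENNReal.toReal_ofReal hx,
    ENNReal.toReal_ofReal hy] at h2
  rw [palmProb, ENNReal.toReal_mul, ENNReal.toReal_inv, ← div_eq_inv_mul, rate]
  have := hN.rate_pos
  gcongr
  linarith

theorem div_le_palmProb (hN : IsRequestProcess P (N i)) {A : Set (ι → Measure ℝ)} {x y : ℝ}
    (hx : 0 ≤ x) (hy : 0 ≤ y)
    (h : ENNReal.ofReal y ≤
      ∫⁻ ω, ∫⁻ s in Ioc 0 1, A.indicator 1 (fun j => shift s (N j ω)) ∂(N i ω) ∂P +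
        ENNReal.ofReal x) :
    (y - x) / rate P N i ≤ palmProb P N i A := by
  have hfin := ((palm_lintegral_le (P := P) (N := N) (i := i) A).trans_lt hN.intensity_lt_top).ne
  have h2 := ENNReal.toReal_mono (ENNReal.add_ne_top.2 ⟨hfin, ENNReal.ofReal_ne_top⟩) h
  rw [ENNReal.toReal_add hfin ENNReal.ofReal_ne_top, ENNReal.toReal_ofReal hx,
    ENNReal.toReal_ofReal hy] at h2
  rw [palmProb, ENNReal.toReal_mul, ENNReal.toReal_inv, ← div_eq_inv_mul, rate]
  have := hN.rate_pos
  gcongr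
  linarith

variable [IsProbabilityMeasure P]

theorem lintegral_sum_indicator {m : ℕ} {U : ℕ → Set Ω} (hU : ∀ k, MeasurableSet (U k)) {u : ℝ}
    (hu : ∀ k, P.real (U k) = u) :
    ∫⁻ ω, ∑ k ∈ Finset.range m, (U k).indicator 1 ω ∂P = ENNReal.ofReal (m * u) := by
  have h1 : ∀ k, ∫⁻ ω, (U k).indicator 1 ω ∂P = ENNReal.ofReal u := fun k => by
    rw [lintegral_indicator_one (hU k), ← hu k, ofReal_measureReal]
  rw [lintegral_finsetSum _ fun k _ => measurable_one.indicator (hU k)]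
  simp [h1, ENNReal.ofReal_mul]

/-- Independence splits each term into the mean count λ_i / m of a cell times P(V k). This is where
the requests of content i are decoupled from the other contents. -/
theorem lintegral_sum_cell_mul_le (hN : IsRequestProcess P (N i)) {m : ℕ} (hm : 0 < m)
    {V : ℕ → Set Ω} (hV : ∀ k, MeasurableSet (V k))
    (hind : ∀ k, IndepFun (N i) ((V k).indicator (1 : Ω → ℝ≥0∞)) P) {v : ℝ}
    (hv : ∀ k, P.real (V k) ≤ v) :
    ∫⁻ ω, ∑ k ∈ Finset.range m, N i ω (Ioc ((k : ℝ) / m) ((k : ℝ) / m + 1 / m)) *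
      (V k).indicator 1 ω ∂P ≤ ENNReal.ofReal (rate P N i * v) := by
  have hm' : (0 : ℝ) < m := by exact_mod_cast hm
  have hR := hN.rate_pos
  have hmeas : ∀ k : ℕ, Measurable fun ω => N i ω (Ioc ((k : ℝ) / m) ((k : ℝ) / m + 1 / m)) :=
    fun k => hN.measurable_eval measurableSet_Ioc
  have hmeasV : ∀ k, Measurable ((V k).indicator (1 : Ω → ℝ≥0∞)) :=
    fun k => measurable_one.indicator (hV k)
  have h1 : ∀ k : ℕ, ∫⁻ ω, N i ω (Ioc ((k : ℝ) / m) ((k : ℝ) / m + 1 / m)) *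
      (V k).indicator 1 ω ∂P ≤ ENNReal.ofReal (rate P N i / m * v) := by
    intro k
    rw [lintegral_mul_eq_lintegral_mul_lintegral_of_indepFun'' (hmeas k).aemeasurable
      (hmeasV k).aemeasurable ((hind k).comp (Measure.measurable_coe measurableSet_Ioc)
      measurable_id), hN.lintegral_cell hm, lintegral_indicator_one (hV k),
      ENNReal.ofReal_mul (by rw [rate]; positivity)]
    gcongr
    · exact le_rfl
    · rw [← ofReal_measureReal]
      exact ENNReal.ofReal_le_ofReal (hv k)
  have hmul : ∀ k : ℕ, Measurable fun ω =>
      N i ω (Ioc ((k : ℝ) / m) ((k : ℝ) / m + 1 / m)) * (V k).indicator (1 : Ω → ℝ≥0∞) ω :=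
    fun k => (hmeas k).mul (hmeasV k)
  rw [lintegral_finsetSum _ fun k _ => hmul k]
  refine (Finset.sum_le_sum fun k _ => h1 k).trans (le_of_eq ?_)
  rw [Finset.sum_const, Finset.card_range, nsmul_eq_mul, ← ENNReal.ofReal_natCast,
    ← ENNReal.ofReal_mul hm'.le]
  congr 1
  field_simp

/-- Upper bound for a Palm probability from bounds on the cells of a grid. -/
theorem palmProb_le_of_grid (hN : IsRequestProcess P (N i)) (A : Set (ι → Measure ℝ)) {m : ℕ}
    (hm : 0 < m) {U V : ℕ → Set Ω} (hU : ∀ k, MeasurableSet (U k)) (hV : ∀ k, MeasurableSet (V k))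
    (hind : ∀ k, IndepFun (N i) ((V k).indicator (1 : Ω → ℝ≥0∞)) P) {u v : ℝ}
    (hu : ∀ k, P.real (U k) = u) (hv : ∀ k, P.real (V k) ≤ v)
    (h : ∀ᵐ ω ∂P, ∀ k : ℕ, ∫⁻ s in Ioc ((k : ℝ) / m) ((k : ℝ) / m + 1 / m),
        A.indicator 1 (fun j => shift s (N j ω)) ∂(N i ω) + (U k).indicator 1 ω ≤
      N i ω (Ioc ((k : ℝ) / m) ((k : ℝ) / m + 1 / m)) +
      N i ω (Ioc ((k : ℝ) / m) ((k : ℝ) / m + 1 / m)) * (V k).indicator 1 ω) :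
    palmProb P N i A ≤ 1 + v - m * u / rate P N i := by
  have hR : 0 < rate P N i := hN.rate_pos
  have hv0 : 0 ≤ v := measureReal_nonneg.trans (hv 0)
  have hu0 : 0 ≤ u := (hu 0) ▸ measureReal_nonneg
  have hone : ∀ ω, ∑ k ∈ Finset.range m, N i ω (Ioc ((k : ℝ) / m) ((k : ℝ) / m + 1 / m)) =
      N i ω (Ioc 0 1) := fun ω => by
    simpa using (lintegral_Ioc_eq_sum_grid (N i ω) (fun _ => 1) hm).symm
  have key := palmProb_le_div hN (A := A) (x := m * u) (y := rate P N i + rate P N i * v)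
    (by positivity) (by positivity) ?_
  · refine key.trans (le_of_eq ?_)
    have : rate P N i ≠ 0 := hR.ne'
    field_simp
  -- The set `A` need not be measurable: additivity of the integral only needs the added term to be
  -- measurable.
  rw [← lintegral_sum_indicator hU hu, ← lintegral_add_right _
    (Finset.measurable_sum _ fun k _ => measurable_one.indicator (hU k)),
    ENNReal.ofReal_add hR.le (by positivity)]
  calc _ ≤ ∫⁻ ω, (N i ω (Ioc 0 1) + ∑ k ∈ Finset.range m,
        N i ω (Ioc ((k : ℝ) / m) ((k : ℝ) / m + 1 / m)) * (V k).indicator 1 ω) ∂P := by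
        refine lintegral_mono_ae ?_
        filter_upwards [h] with ω hω
        rw [lintegral_Ioc_eq_sum_grid _ _ hm, ← hone, ← Finset.sum_add_distrib,
          ← Finset.sum_add_distrib]
        exact Finset.sum_le_sum fun k _ => hω k
    _ ≤ _ := by
        rw [lintegral_add_left (hN.measurable_eval measurableSet_Ioc)]
        gcongr
        · exact (ENNReal.ofReal_toReal hN.intensity_lt_top.ne).ge
        · exact lintegral_sum_cell_mul_le hN hm hV hind hv

/-- Lower bound for a Palm probability from bounds on the cells of a grid. -/
theorem le_palmProb_of_grid (hN : IsRequestProcess P (N i)) (A : Set (ι → Measure ℝ)) {m : ℕ}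
    (hm : 0 < m) {U V : ℕ → Set Ω} (hU : ∀ k, MeasurableSet (U k)) (hV : ∀ k, MeasurableSet (V k))
    (hind : ∀ k, IndepFun (N i) ((V k).indicator (1 : Ω → ℝ≥0∞)) P) {u v : ℝ}
    (hu : ∀ k, P.real (U k) = u) (hv : ∀ k, P.real (V k) ≤ v)
    (h : ∀ᵐ ω ∂P, ∀ k : ℕ, N i ω (Ioc ((k : ℝ) / m) ((k : ℝ) / m + 1 / m)) ≤
      ∫⁻ s in Ioc ((k : ℝ) / m) ((k : ℝ) / m + 1 / m),
        A.indicator 1 (fun j => shift s (N j ω)) ∂(N i ω) + ((U k).indicator 1 ω +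
      N i ω (Ioc ((k : ℝ) / m) ((k : ℝ) / m + 1 / m)) * (V k).indicator 1 ω)) :
    1 - v - m * u / rate P N i ≤ palmProb P N i A := by
  have hR : 0 < rate P N i := hN.rate_pos
  have hv0 : 0 ≤ v := measureReal_nonneg.trans (hv 0)
  have hu0 : 0 ≤ u := (hu 0) ▸ measureReal_nonneg
  have hone : ∀ ω, ∑ k ∈ Finset.range m, N i ω (Ioc ((k : ℝ) / m) ((k : ℝ) / m + 1 / m)) =
      N i ω (Ioc 0 1) := fun ω => by
    simpa using (lintegral_Ioc_eq_sum_grid (N i ω) (fun _ => 1) hm).symm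
  have hRv : 0 ≤ rate P N i * v := by positivity
  have key := div_le_palmProb hN (A := A) (x := m * u + rate P N i * v) (y := rate P N i)
    (by positivity) hR.le ?_
  · refine (le_of_eq ?_).trans key
    have : rate P N i ≠ 0 := hR.ne'
    field_simp
    ring
  have hmeasU : Measurable fun ω => ∑ k ∈ Finset.range m, (U k).indicator (1 : Ω → ℝ≥0∞) ω :=
    Finset.measurable_sum _ fun k _ => measurable_one.indicator (hU k)
  have hmeasV : Measurable fun ω => ∑ k ∈ Finset.range m,
      N i ω (Ioc ((k : ℝ) / m) ((k : ℝ) / m + 1 / m)) * (V k).indicator (1 : Ω → ℝ≥0∞) ω :=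
    Finset.measurable_sum _ fun k _ =>
      (hN.measurable_eval measurableSet_Ioc).mul (measurable_one.indicator (hV k))
  have hmeasUV : Measurable fun ω => ∑ k ∈ Finset.range m, (U k).indicator (1 : Ω → ℝ≥0∞) ω +
      ∑ k ∈ Finset.range m,
        N i ω (Ioc ((k : ℝ) / m) ((k : ℝ) / m + 1 / m)) * (V k).indicator (1 : Ω → ℝ≥0∞) ω :=
    hmeasU.add hmeasV
  rw [ENNReal.ofReal_add (by positivity) hRv, ← lintegral_sum_indicator hU hu]
  calc ENNReal.ofReal (rate P N i) = ∫⁻ ω, N i ω (Ioc 0 1) ∂P :=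
        ENNReal.ofReal_toReal hN.intensity_lt_top.ne
    _ ≤ ∫⁻ ω, (∫⁻ s in Ioc 0 1, A.indicator 1 (fun j => shift s (N j ω)) ∂(N i ω) +
        (∑ k ∈ Finset.range m, (U k).indicator (1 : Ω → ℝ≥0∞) ω + ∑ k ∈ Finset.range m,
        N i ω (Ioc ((k : ℝ) / m) ((k : ℝ) / m + 1 / m)) * (V k).indicator (1 : Ω → ℝ≥0∞) ω)) ∂P := by
        refine lintegral_mono_ae ?_
        filter_upwards [h] with ω hω
        rw [lintegral_Ioc_eq_sum_grid _ _ hm, ← hone, ← Finset.sum_add_distrib,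
          ← Finset.sum_add_distrib]
        exact Finset.sum_le_sum fun k _ => hω k
    _ ≤ _ := by
        rw [lintegral_add_right _ hmeasUV, lintegral_add_left hmeasU]
        gcongr
        exact lintegral_sum_cell_mul_le hN hm hV hind hv

/-- The increment of the window probability over a cell, normalised. -/
noncomputable def hitSlope (P : Measure Ω) (N : ι → Ω → Measure ℝ) (i : ι) (m : ℕ) (t : ℝ) : ℝ :=
  m * (hitProb P (N i) (t + 1 / m) - hitProb P (N i) t) / rate P N i

/-- Serves the grid bounds with `V` empty, for events that involve content `i` alone. -/
theorem indepFun_indicator_empty (f : Ω → Measure ℝ) :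
    IndepFun f ((∅ : Set Ω).indicator (1 : Ω → ℝ≥0∞)) P := by
  rw [indicator_empty]
  exact indepFun_const_right f 0

theorem interCdf_le_one_sub_hitSlope (hN : IsRequestProcess P (N i)) {m : ℕ} (hm : 0 < m)
    {t : ℝ} (ht : 0 ≤ t) : interCdf P N i t ≤ 1 - hitSlope P N i m t := by
  have hm' : (0 : ℝ) < m := by exact_mod_cast hm
  have key := palmProb_le_of_grid hN {μ | μ i (Ioc 0 t) ≠ 0} hm (V := fun _ => ∅) (v := 0)
    (U := fun k => {ω | N i ω (Ioc ((k : ℝ) / m) ((k : ℝ) / m + 1 / m)) ≠ 0 ∧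
      N i ω (Ioc ((k : ℝ) / m + 1 / m) ((k : ℝ) / m + 1 / m + t)) = 0})
    (fun k => (hN.measurableSet_ne measurableSet_Ioc).inter (hN.measurableSet_eq measurableSet_Ioc))
    (fun _ => MeasurableSet.empty) (fun _ => indepFun_indicator_empty _)
    (fun k => hN.prob_gap_right _ (by positivity) ht) (by simp) ?_
  · rwa [add_zero] at key
  filter_upwards [hN.simple] with ω hω k
  classical
  have h := hω.count_succ_le ((k : ℝ) / m) (1 / m) t
  simp only [indicator, mem_empty_iff_false, if_false, mul_zero, add_zero, mem_ofPred_eq,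
    shift_Ioc_zero, Pi.one_apply] at h ⊢
  convert h

theorem one_sub_hitSlope_le_interCdf (hN : IsRequestProcess P (N i)) {m : ℕ} (hm : 0 < m)
    {t : ℝ} (ht : 0 ≤ t) : 1 - hitSlope P N i m t ≤ interCdf P N i (t + 1 / m) := by
  have hm' : (0 : ℝ) < m := by exact_mod_cast hm
  have key := le_palmProb_of_grid hN {μ | μ i (Ioc 0 (t + 1 / m)) ≠ 0} hm (V := fun _ => ∅) (v := 0)
    (U := fun k => {ω | N i ω (Ioc ((k : ℝ) / m) ((k : ℝ) / m + 1 / m)) ≠ 0 ∧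
      N i ω (Ioc ((k : ℝ) / m + 1 / m) ((k : ℝ) / m + 1 / m + t)) = 0})
    (fun k => (hN.measurableSet_ne measurableSet_Ioc).inter (hN.measurableSet_eq measurableSet_Ioc))
    (fun _ => MeasurableSet.empty) (fun _ => indepFun_indicator_empty _)
    (fun k => hN.prob_gap_right _ (by positivity) ht) (by simp) ?_
  · rwa [sub_zero] at key
  filter_upwards [hN.simple] with ω hω k
  classical
  have h := hω.le_count_succ ((k : ℝ) / m) (1 / m) t ht
  simp only [indicator, mem_empty_iff_false, if_false, mul_zero, add_zero, mem_ofPred_eq,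
    shift_Ioc_zero, Pi.one_apply] at h ⊢
  convert h

/-- Palm bound for an event contained in the union of a hit of content `i` and an event controlled
by the other contents. -/
theorem palmProb_le_one_sub_hitSlope (hN : IsRequestProcess P (N i)) {m : ℕ} (hm : 0 < m)
    {t : ℝ} (ht : 0 ≤ t) (A : Set (ι → Measure ℝ)) {V : ℕ → Set Ω}
    (hV : ∀ k, MeasurableSet (V k))
    (hind : ∀ k, IndepFun (N i) ((V k).indicator (1 : Ω → ℝ≥0∞)) P) {v : ℝ}
    (hv : ∀ k, P.real (V k) ≤ v)
    (h : ∀ ω, ∀ k : ℕ, ∀ s ∈ Ioc ((k : ℝ) / m) ((k : ℝ) / m + 1 / m),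
      (fun j => shift s (N j ω)) ∈ A → ω ∉ V k → N i ω (Ico (s - t) s) ≠ 0) :
    palmProb P N i A ≤ 1 + v - hitSlope P N i m t := by
  have hm' : (0 : ℝ) < m := by exact_mod_cast hm
  refine palmProb_le_of_grid hN A hm (V := V) (v := v)
    (U := fun k => {ω | N i ω (Ioc ((k : ℝ) / m) ((k : ℝ) / m + 1 / m)) ≠ 0 ∧
      N i ω (Icc ((k : ℝ) / m - t) ((k : ℝ) / m)) = 0})
    (fun k => (hN.measurableSet_ne measurableSet_Ioc).inter (hN.measurableSet_eq measurableSet_Icc))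
    hV hind (fun k => hN.prob_gap_left _ (by positivity) ht) hv ?_
  filter_upwards [hN.simple] with ω hω k
  classical
  have h1 := hω.count_pred_le ((k : ℝ) / m) (1 / m) t
  have h2 : ∫⁻ s in Ioc ((k : ℝ) / m) ((k : ℝ) / m + 1 / m),
      A.indicator 1 (fun j => shift s (N j ω)) ∂(N i ω) ≤
      ∫⁻ s in Ioc ((k : ℝ) / m) ((k : ℝ) / m + 1 / m),
        {s | N i ω (Ico (s - t) s) ≠ 0}.indicator 1 s ∂(N i ω) +
      N i ω (Ioc ((k : ℝ) / m) ((k : ℝ) / m + 1 / m)) * (V k).indicator 1 ω := by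
    -- The product of the cell count and the indicator of `V k` is the integral of a constant over
    -- the cell, so a pointwise comparison in `s` suffices.
    rw [mul_comm, ← setLIntegral_const, ← lintegral_add_right _ measurable_const]
    refine setLIntegral_mono' measurableSet_Ioc fun s hs => ?_
    by_cases hA : (fun j => shift s (N j ω)) ∈ A
    · by_cases hVk : ω ∈ V k
      · simp [hVk, hA]
      · simp [hVk, hA, h ω k s hs hA hVk]
    · simp [hA]
  refine (add_le_add_left h2 _).trans ?_
  rw [add_right_comm]
  refine add_le_add_left (le_trans (le_of_eq ?_) h1) _
  simp only [indicator, mem_ofPred_eq, Pi.one_apply]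

/-- Palm bound for an event containing a hit of content `i` outside an event controlled
by the other contents. -/
theorem one_sub_hitSlope_le_palmProb (hN : IsRequestProcess P (N i)) {m : ℕ} (hm : 0 < m)
    {t : ℝ} (ht : 0 ≤ t) (A : Set (ι → Measure ℝ)) {V : ℕ → Set Ω}
    (hV : ∀ k, MeasurableSet (V k))
    (hind : ∀ k, IndepFun (N i) ((V k).indicator (1 : Ω → ℝ≥0∞)) P) {v : ℝ}
    (hv : ∀ k, P.real (V k) ≤ v)
    (h : ∀ ω, ∀ k : ℕ, ∀ s ∈ Ioc ((k : ℝ) / m) ((k : ℝ) / m + 1 / m),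
      N i ω (Ico (s - (t + 1 / m)) s) ≠ 0 → ω ∉ V k → (fun j => shift s (N j ω)) ∈ A) :
    1 - v - hitSlope P N i m t ≤ palmProb P N i A := by
  have hm' : (0 : ℝ) < m := by exact_mod_cast hm
  refine le_palmProb_of_grid hN A hm (V := V) (v := v)
    (U := fun k => {ω | N i ω (Ioc ((k : ℝ) / m) ((k : ℝ) / m + 1 / m)) ≠ 0 ∧
      N i ω (Icc ((k : ℝ) / m - t) ((k : ℝ) / m)) = 0})
    (fun k => (hN.measurableSet_ne measurableSet_Ioc).inter (hN.measurableSet_eq measurableSet_Icc))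
    hV hind (fun k => hN.prob_gap_left _ (by positivity) ht) hv ?_
  filter_upwards [hN.simple] with ω hω k
  classical
  have h1 := hω.le_count_pred ((k : ℝ) / m) (1 / m) t ht
  have h2 : ∫⁻ s in Ioc ((k : ℝ) / m) ((k : ℝ) / m + 1 / m),
        {s | N i ω (Ico (s - (t + 1 / m)) s) ≠ 0}.indicator 1 s ∂(N i ω) ≤
      ∫⁻ s in Ioc ((k : ℝ) / m) ((k : ℝ) / m + 1 / m),
      A.indicator 1 (fun j => shift s (N j ω)) ∂(N i ω) +
      N i ω (Ioc ((k : ℝ) / m) ((k : ℝ) / m + 1 / m)) * (V k).indicator 1 ω := by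
    rw [mul_comm, ← setLIntegral_const, ← lintegral_add_right _ measurable_const]
    refine setLIntegral_mono' measurableSet_Ioc fun s hs => ?_
    by_cases hA : N i ω (Ico (s - (t + 1 / m)) s) ≠ 0
    · by_cases hVk : ω ∈ V k
      · rw [indicator_of_mem (show s ∈ {s | N i ω (Ico (s - (t + 1 / m)) s) ≠ 0} from hA)]
        simp [hVk]
      · simp [hVk, indicator_of_mem (h ω k s hs hA hVk)]
        exact indicator_le_self' (fun _ _ => zero_le) _
    · rw [indicator_of_notMem (show s ∉ {s | N i ω (Ico (s - (t + 1 / m)) s) ≠ 0} from hA)]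
      exact zero_le
  refine (h1.trans (add_le_add_left h2 _)).trans (le_of_eq ?_)
  rw [add_assoc, add_comm (_ * _)]
  simp only [indicator, mem_ofPred_eq, Pi.one_apply]

end palm
end palmBounds

/-! ### The inversion formula for window probabilities -/

theorem integral_one_sub_bounds {G : ℝ → ℝ} (hmono : Monotone G) (hcont : Continuous G)
    {a b : ℝ} (hab : a ≤ b) :
    (b - a) * (1 - G b) ≤ ∫ s in a..b, (1 - G s) ∧
      ∫ s in a..b, (1 - G s) ≤ (b - a) * (1 - G a) := by
  have hint : IntervalIntegrable (fun s => 1 - G s) volume a b :=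
    (continuous_const.sub hcont).intervalIntegrable _ _
  constructor
  · have := intervalIntegral.integral_mono_on hab (intervalIntegrable_const (c := 1 - G b)) hint
      fun x hx => by linarith [hmono hx.2]
    rwa [intervalIntegral.integral_const, smul_eq_mul] at this
  · have := intervalIntegral.integral_mono_on hab hint (intervalIntegrable_const (c := 1 - G a))
      fun x hx => by linarith [hmono hx.1]
    rwa [intervalIntegral.integral_const, smul_eq_mul] at this

/-- A function whose increments over all cells of mesh `1 / m` are sandwiched like those of
`r ∫ (1 - G)` equals this integral. -/
theorem eq_integral_of_increments {r : ℝ} (hr : 0 < r) {G F : ℝ → ℝ} (hmono : Monotone G)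
    (hcont : Continuous G) (hG0 : ∀ t, 0 ≤ G t) (hG1 : ∀ t, G t ≤ 1) (hF : Monotone F)
    (hF0 : F 0 = 0)
    (hlow : ∀ m : ℕ, 0 < m → ∀ t, 0 ≤ t → r * (1 - G (t + 1 / m)) / m ≤ F (t + 1 / m) - F t)
    (hup : ∀ m : ℕ, 0 < m → ∀ t, 0 ≤ t → F (t + 1 / m) - F t ≤ r * (1 - G t) / m)
    {t : ℝ} (ht : 0 ≤ t) : F t = r * ∫ s in (0 : ℝ)..t, (1 - G s) := by
  set J : ℝ → ℝ := fun t => r * ∫ s in (0 : ℝ)..t, (1 - G s) with hJ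
  have hint : ∀ a b, IntervalIntegrable (fun s => 1 - G s) volume a b :=
    fun a b => (continuous_const.sub hcont).intervalIntegrable _ _
  have hJsub : ∀ a b, J b - J a = r * ∫ s in a..b, (1 - G s) := fun a b => by
    simp only [hJ]
    rw [← mul_sub, intervalIntegral.integral_interval_sub_left (hint _ _) (hint _ _)]
  have hJlow : ∀ a b, a ≤ b → r * ((b - a) * (1 - G b)) ≤ J b - J a := fun a b hab => by
    rw [hJsub]
    exact mul_le_mul_of_nonneg_left (integral_one_sub_bounds hmono hcont hab).1 hr.le
  have hJup : ∀ a b, a ≤ b → J b - J a ≤ r * ((b - a) * (1 - G a)) := fun a b hab => by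
    rw [hJsub]
    exact mul_le_mul_of_nonneg_left (integral_one_sub_bounds hmono hcont hab).2 hr.le
  have hJmono : Monotone J := fun a b hab => by
    have := hJlow a b hab
    have : 0 ≤ r * ((b - a) * (1 - G b)) :=
      mul_nonneg hr.le (mul_nonneg (sub_nonneg.2 hab) (sub_nonneg.2 (hG1 b)))
    linarith
  -- The increments of `F` and `J` over a cell lie between the same two bounds, so they differ by at
  -- most `r / m` times the increment of `G` there. These errors telescope.
  have hgrid : ∀ m : ℕ, 0 < m → ∀ k : ℕ,
      |F (k / m) - J (k / m)| ≤ r / m * (G (k / m) - G 0) := by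
    intro m hm k
    have hm' : (0 : ℝ) < m := by exact_mod_cast hm
    induction k with
    | zero => simp [hF0, hJ]
    | succ k ih =>
      have hk : (0 : ℝ) ≤ k / m := by positivity
      have e : ((k + 1 : ℕ) : ℝ) / m = k / m + 1 / m := by push_cast; ring
      have h1 := hlow m hm _ hk
      have h2 := hup m hm _ hk
      have h3 := hJlow (k / m) (k / m + 1 / m) (by simp)
      have h4 := hJup (k / m) (k / m + 1 / m) (by simp)
      rw [add_sub_cancel_left] at h3 h4
      rw [e]
      rw [abs_le] at ih ⊢
      have e1 : ∀ x, r * (1 / (m : ℝ) * (1 - x)) = r / m - r / m * x := fun x => by ring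
      have e2 : ∀ x, r * (1 - x) / (m : ℝ) = r / m - r / m * x := fun x => by ring
      rw [e1] at h3 h4
      rw [e2] at h1 h2
      constructor <;> linarith [ih.1, ih.2]
  -- Between grid points both functions are monotone and rise by at most `r / M` per cell; the grid
  -- error adds another `r / M`.
  have hbound : ∀ m : ℕ, |F t - J t| ≤ 2 * r / ((m : ℝ) + 1) := by
    intro m
    have hm' : (0 : ℝ) < (m + 1 : ℕ) := by positivity
    set M : ℕ := m + 1 with hM
    set k : ℕ := ⌊t * M⌋₊ with hk
    have hk1 : (k : ℝ) / M ≤ t := by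
      rw [div_le_iff₀ hm']
      exact Nat.floor_le (by positivity)
    have hk2 : t ≤ k / M + 1 / M := by
      rw [← add_div, le_div_iff₀ hm']
      exact (Nat.lt_floor_add_one _).le
    have hg := hgrid M (Nat.succ_pos m) k
    have hrM : 0 < r / (M : ℝ) := by positivity
    have hg' : |F (k / M) - J (k / M)| ≤ r / M := by
      refine hg.trans ?_
      nlinarith [hG1 (k / M), hG0 0]
    have h2 := hup M (Nat.succ_pos m) (k / M) (by positivity)
    have h4 := hJup (k / M) (k / M + 1 / M) (by simp)
    rw [add_sub_cancel_left] at h4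
    have e1 : ∀ x, r * (1 / (M : ℝ) * (1 - x)) = r / M - r / M * x := fun x => by ring
    have e2 : ∀ x, r * (1 - x) / (M : ℝ) = r / M - r / M * x := fun x => by ring
    rw [e1] at h4
    rw [e2] at h2
    have hGp : 0 ≤ r / M * G (k / M) := mul_nonneg hrM.le (hG0 _)
    have := hF hk1
    have := hF hk2
    have := hJmono hk1
    have := hJmono hk2
    have e3 : 2 * r / ((m : ℝ) + 1) = r / M + r / M := by
      rw [hM]; push_cast; ring
    rw [e3]
    rw [abs_le] at hg' ⊢
    constructor <;> linarith [hg'.1, hg'.2]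
  have hlim : Tendsto (fun m : ℕ => 2 * r / ((m : ℝ) + 1)) atTop (𝓝 0) :=
    tendsto_const_nhds.div_atTop (tendsto_atTop_add_const_right _ _ tendsto_natCast_atTop_atTop)
  have h0 := ge_of_tendsto' hlim hbound
  exact sub_eq_zero.1 (abs_eq_zero.1 (le_antisymm h0 (abs_nonneg _)))

/-- A window probability `F` of a process with rate `r` and inter-request cdf `G`. -/
structure IsHitProfile (r : ℝ) (G F : ℝ → ℝ) : Prop where
  rate_pos : 0 < r
  mono : Monotone G
  cont : Continuous G
  nonneg : ∀ t, 0 ≤ G t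
  le_one : ∀ t, G t ≤ 1
  hit_le_one : ∀ t, F t ≤ 1
  hit_eq : ∀ t, 0 ≤ t → F t = r * ∫ s in (0 : ℝ)..t, (1 - G s)

/-! ### Consequences of the inversion formula for a single content -/

namespace IsHitProfile
variable {r : ℝ} {G F : ℝ → ℝ} (h : IsHitProfile r G F)
include h

theorem sub_eq {a b : ℝ} (ha : 0 ≤ a) (hb : 0 ≤ b) : F b - F a = r * ∫ s in a..b, (1 - G s) := by
  have hint : ∀ a b, IntervalIntegrable (fun s => 1 - G s) volume a b :=
    fun a b => (continuous_const.sub h.cont).intervalIntegrable _ _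
  rw [h.hit_eq a ha, h.hit_eq b hb, ← mul_sub,
    intervalIntegral.integral_interval_sub_left (hint _ _) (hint _ _)]

theorem le_sub {a b : ℝ} (ha : 0 ≤ a) (hab : a ≤ b) : r * (b - a) * (1 - G b) ≤ F b - F a := by
  rw [h.sub_eq ha (ha.trans hab), mul_assoc]
  exact mul_le_mul_of_nonneg_left (integral_one_sub_bounds h.mono h.cont hab).1 h.rate_pos.le

theorem sub_le {a b : ℝ} (ha : 0 ≤ a) (hab : a ≤ b) : F b - F a ≤ r * (b - a) * (1 - G a) := by
  rw [h.sub_eq ha (ha.trans hab), mul_assoc]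
  exact mul_le_mul_of_nonneg_left (integral_one_sub_bounds h.mono h.cont hab).2 h.rate_pos.le

theorem zero : F 0 = 0 := by simp [h.hit_eq 0 le_rfl]

theorem hit_mono {a b : ℝ} (ha : 0 ≤ a) (hab : a ≤ b) : F a ≤ F b := by
  have := h.le_sub ha hab
  have := mul_nonneg (mul_nonneg h.rate_pos.le (sub_nonneg.2 hab)) (sub_nonneg.2 (h.le_one b))
  linarith

theorem hit_nonneg {a : ℝ} (ha : 0 ≤ a) : 0 ≤ F a := h.zero ▸ h.hit_mono le_rfl ha

theorem hit_le {t : ℝ} (ht : 0 ≤ t) : F t ≤ r * t := by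
  have h1 := h.sub_le le_rfl ht
  rw [h.zero, sub_zero, sub_zero] at h1
  exact h1.trans (mul_le_of_le_one_right (mul_nonneg h.rate_pos.le ht) (by linarith [h.nonneg 0]))

/-- The tail of the inter-request time is bounded by Markov's inequality. -/
theorem mul_one_sub_le {t : ℝ} (ht : 0 ≤ t) : r * t * (1 - G t) ≤ 1 := by
  have h1 := h.le_sub le_rfl ht
  rw [h.zero, sub_zero, sub_zero] at h1
  exact h1.trans (h.hit_le_one t)

/-- Concavity of `F`: both increments are compared with `r * t * (1 - G t)`. -/
theorem hit_two_mul_le {t : ℝ} (ht : 0 ≤ t) : F (2 * t) ≤ 2 * F t := by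
  have h1 := h.sub_le ht (by linarith : t ≤ 2 * t)
  have h2 := h.le_sub le_rfl ht
  rw [h.zero, sub_zero, sub_zero] at h2
  rw [show 2 * t - t = t by ring] at h1
  linarith

theorem continuousOn : ContinuousOn F (Ici 0) := by
  have h1 : Continuous fun t => r * ∫ s in (0 : ℝ)..t, (1 - G s) :=
    continuous_const.mul (intervalIntegral.continuous_primitive
      (fun a b => (continuous_const.sub h.cont).intervalIntegrable _ _) 0)
  exact h1.continuousOn.congr fun t ht => h.hit_eq t ht

end IsHitProfile

section ttl

variable {Ω : Type*} [MeasurableSpace Ω] {P : Measure Ω} [IsProbabilityMeasure P]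
  {ι : Type*} {N : ι → Ω → Measure ℝ} {i : ι}

omit [IsProbabilityMeasure P] in
theorem interCdf_mono (hN : IsRequestProcess P (N i)) : Monotone (interCdf P N i) :=
  fun _ _ hst => palmProb_mono hN fun _ hμ h0 =>
    hμ (measure_mono_null (Ioc_subset_Ioc_right hst) h0)

theorem isHitProfile (hN : IsRequestProcess P (N i)) (hG : Continuous (interCdf P N i)) :
    IsHitProfile (rate P N i) (interCdf P N i) (hitProb P (N i)) where
  rate_pos := hN.rate_pos
  mono := interCdf_mono hN
  cont := hG
  nonneg _ := palmProb_nonneg _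
  le_one _ := palmProb_le_one hN _
  hit_le_one := hitProb_le_one (N i)
  hit_eq t ht := by
    have hR : 0 < rate P N i := hN.rate_pos
    refine eq_integral_of_increments hR (interCdf_mono hN) hG (fun _ => palmProb_nonneg _)
      (fun _ => palmProb_le_one hN _) (fun _ _ hst => hitProb_mono hst) (hitProb_zero _) ?_ ?_ ht
    · intro m hm t ht
      have hm' : (0 : ℝ) < m := by exact_mod_cast hm
      have h := one_sub_hitSlope_le_interCdf hN hm ht
      rw [hitSlope, sub_le_comm, le_div_iff₀ hR] at h
      rw [div_le_iff₀ hm']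
      linarith
    · intro m hm t ht
      have hm' : (0 : ℝ) < m := by exact_mod_cast hm
      have h := interCdf_le_one_sub_hitSlope hN hm ht
      rw [hitSlope, le_sub_comm, div_le_iff₀ hR] at h
      rw [le_div_iff₀ hm']
      linarith

/-! ### The TTL hit probability -/

theorem requested_eq_one_iff (μ : Measure ℝ) (t : EReal) :
    requested μ t = 1 ↔ μ (pastWindow t) ≠ 0 := by
  unfold requested
  split_ifs with h <;> simp [h]

/-- Looking back and looking forward produce gaps of the same probability, so both Palm
probabilities are compared with the same slope of the window probability. This traps the TTL value
between `interCdf` at `T - 1 / m` and at `T + 1 / m`, and continuity closes the interval. -/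
theorem hitTTL_eq_interCdf {n : ℕ} {N : Fin n → Ω → Measure ℝ} {i : Fin n}
    (hN : IsRequestProcess P (N i)) (hG : Continuous (interCdf P N i)) {T : ℝ} (hT : 0 < T) :
    hitTTL P N T i = interCdf P N i T := by
  have hup : ∀ m : ℕ, 0 < m → hitTTL P N T i ≤ interCdf P N i (T + 1 / m) := by
    intro m hm
    have h1 := palmProb_le_one_sub_hitSlope hN hm hT.le
      {μ | requested (μ i) (T : EReal) = 1} (V := fun _ => ∅) (v := 0)
      (fun _ => MeasurableSet.empty) (fun _ => indepFun_indicator_empty _) (by simp)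
      (fun ω k s _ hA _ => by
        rw [mem_ofPred_eq, requested_eq_one_iff, shift_pastWindow] at hA
        exact hA)
    have h2 := one_sub_hitSlope_le_interCdf hN hm hT.le
    rw [add_zero] at h1
    exact h1.trans h2
  have hlow : ∀ m : ℕ, 0 < m → 1 / (m : ℝ) ≤ T → interCdf P N i (T - 1 / m) ≤ hitTTL P N T i := by
    intro m hm hmT
    have h1 := one_sub_hitSlope_le_palmProb hN hm (sub_nonneg.2 hmT)
      {μ | requested (μ i) (T : EReal) = 1} (V := fun _ => ∅) (v := 0)
      (fun _ => MeasurableSet.empty) (fun _ => indepFun_indicator_empty _) (by simp)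
      (fun ω k s _ hA _ => by
        rw [mem_ofPred_eq, requested_eq_one_iff, shift_pastWindow]
        rwa [sub_add_cancel] at hA)
    have h2 := interCdf_le_one_sub_hitSlope hN hm (sub_nonneg.2 hmT)
    rw [sub_zero] at h1
    exact h2.trans h1
  have hlim : Tendsto (fun m : ℕ => 1 / (m : ℝ)) atTop (𝓝 0) := tendsto_one_div_atTop_nhds_zero_nat
  refine le_antisymm ?_ ?_
  · have h1 : Tendsto (fun m : ℕ => interCdf P N i (T + 1 / m)) atTop (𝓝 (interCdf P N i (T + 0))) :=
      (hG.tendsto _).comp (tendsto_const_nhds.add hlim)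
    rw [add_zero] at h1
    exact ge_of_tendsto h1 ((eventually_gt_atTop 0).mono hup)
  · have h1 : Tendsto (fun m : ℕ => interCdf P N i (T - 1 / m)) atTop (𝓝 (interCdf P N i (T - 0))) :=
      (hG.tendsto _).comp (tendsto_const_nhds.sub hlim)
    rw [sub_zero] at h1
    refine le_of_tendsto h1 ?_
    filter_upwards [eventually_gt_atTop 0, hlim.eventually_le_const hT] with m hm hmT
    exact hlow m hm hmT

end ttl

section lru

variable {Ω : Type*} [MeasurableSpace Ω] {P : Measure Ω} [IsProbabilityMeasure P]

/-! ### Chernoff bounds for sums of independent indicators -/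

section chernoff
variable {ι : Type*} {E : ι → Set Ω}

theorem mgf_indicator {i : ι} (hE : MeasurableSet (E i)) (t : ℝ) :
    mgf ((E i).indicator 1) P t = 1 + P.real (E i) * (Real.exp t - 1) := by
  have h1 : ∀ ω, Real.exp (t * (E i).indicator 1 ω) =
      1 + (E i).indicator (fun _ => Real.exp t - 1) ω := by
    intro ω
    by_cases h : ω ∈ E i <;> simp [h]
  rw [mgf, integral_congr_ae (ae_of_all _ h1), integral_add (integrable_const _)
    ((integrable_const _).indicator hE), integral_indicator_const _ hE]
  simp

/-- Each factor `1 + p (exp t - 1)` is at most `exp (p (t + t ^ 2))`, since `exp t - 1 ≤ t + t ^ 2`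
for `|t| ≤ 1`. -/
theorem mgf_sum_indicator_le (hE : ∀ i, MeasurableSet (E i))
    (hind : iIndepFun (fun i => (E i).indicator (1 : Ω → ℝ)) P) (s : Finset ι) {t : ℝ}
    (ht : |t| ≤ 1) :
    mgf (∑ i ∈ s, (E i).indicator 1) P t ≤
      Real.exp ((∑ i ∈ s, P.real (E i)) * (t + t ^ 2)) := by
  rw [hind.mgf_sum (fun i => measurable_one.indicator (hE i)), Finset.sum_mul, Real.exp_sum]
  refine Finset.prod_le_prod (fun i _ => mgf_nonneg) fun i _ => ?_
  rw [mgf_indicator (hE i)]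
  have h1 := (abs_le.1 (Real.abs_exp_sub_one_sub_id_le ht)).2
  have h2 := Real.add_one_le_exp (P.real (E i) * (t + t ^ 2))
  have h3 : P.real (E i) * (Real.exp t - 1) ≤ P.real (E i) * (t + t ^ 2) :=
    mul_le_mul_of_nonneg_left (by linarith) measureReal_nonneg
  linarith

theorem integrable_exp_sum_indicator (hE : ∀ i, MeasurableSet (E i)) (s : Finset ι) (t : ℝ) :
    Integrable (fun ω => Real.exp (t * (∑ i ∈ s, (E i).indicator (1 : Ω → ℝ)) ω)) P := by
  refine Integrable.of_bound (C := Real.exp (|t| * s.card)) ?_ (ae_of_all _ fun ω => ?_)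
  · refine (Real.measurable_exp.comp (measurable_const.mul ?_)).aestronglyMeasurable
    simp only [Finset.sum_fn]
    exact Finset.measurable_sum _ fun i _ => measurable_one.indicator (hE i)
  · rw [Real.norm_eq_abs, Real.abs_exp, Real.exp_le_exp, Finset.sum_apply]
    have h0 : ∀ i, 0 ≤ (E i).indicator (1 : Ω → ℝ) ω :=
      fun i => indicator_nonneg (fun _ _ => zero_le_one) _
    have h1 : ∑ i ∈ s, (E i).indicator (1 : Ω → ℝ) ω ≤ s.card := by
      have : ∀ i ∈ s, (E i).indicator (1 : Ω → ℝ) ω ≤ 1 :=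
        fun i _ => indicator_le_self' (fun _ _ => zero_le_one) _
      simpa using Finset.sum_le_sum this
    have h2 : 0 ≤ ∑ i ∈ s, (E i).indicator (1 : Ω → ℝ) ω := Finset.sum_nonneg fun i _ => h0 i
    calc t * ∑ i ∈ s, (E i).indicator (1 : Ω → ℝ) ω
        ≤ |t| * ∑ i ∈ s, (E i).indicator (1 : Ω → ℝ) ω :=
          mul_le_mul_of_nonneg_right (le_abs_self t) h2
      _ ≤ _ := mul_le_mul_of_nonneg_left h1 (abs_nonneg t)

/-- The choice `t = a / (2 * D)` minimises `D * t ^ 2 - t * a`, and `a ≤ 2 * D` keeps `t` in the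
range of the mgf bound. The mean enters the variance term only through its upper bound `D`. -/
theorem chernoff_upper (hE : ∀ i, MeasurableSet (E i))
    (hind : iIndepFun (fun i => (E i).indicator (1 : Ω → ℝ)) P) (s : Finset ι) {D a c : ℝ}
    (hD : 0 < D) (hmean : ∑ i ∈ s, P.real (E i) ≤ D) (ha : 0 ≤ a) (haD : a ≤ 2 * D)
    (hc : ∑ i ∈ s, P.real (E i) + a ≤ c) :
    P.real {ω | c ≤ ∑ i ∈ s, (E i).indicator (1 : Ω → ℝ) ω} ≤ Real.exp (-(a ^ 2 / (4 * D))) := by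
  have ht0 : 0 ≤ a / (2 * D) := by positivity
  have ht1 : |a / (2 * D)| ≤ 1 := by
    rw [abs_of_nonneg ht0, div_le_one (by positivity)]
    exact haD
  have h1 := measure_ge_le_exp_mul_mgf c ht0 (integrable_exp_sum_indicator (P := P) hE s _)
  simp only [Finset.sum_apply] at h1
  refine h1.trans ((mul_le_mul_of_nonneg_left (mgf_sum_indicator_le hE hind s ht1)
    (Real.exp_pos _).le).trans ?_)
  rw [← Real.exp_add, Real.exp_le_exp]
  set t := a / (2 * D) with ht
  set μ := ∑ i ∈ s, P.real (E i)
  have e1 : a = 2 * D * t := by rw [ht]; field_simp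
  have e2 : a ^ 2 / (4 * D) = D * t ^ 2 := by rw [e1]; field_simp; ring
  have h2 : t * (μ + a) ≤ t * c := mul_le_mul_of_nonneg_left hc ht0
  have h3 : μ * t ^ 2 ≤ D * t ^ 2 := mul_le_mul_of_nonneg_right hmean (sq_nonneg t)
  have h4 : t * a = 2 * (D * t ^ 2) := by rw [e1]; ring
  rw [e2]
  linarith

theorem chernoff_lower (hE : ∀ i, MeasurableSet (E i))
    (hind : iIndepFun (fun i => (E i).indicator (1 : Ω → ℝ)) P) (s : Finset ι) {D a c : ℝ}
    (hD : 0 < D) (hmean : ∑ i ∈ s, P.real (E i) ≤ D) (ha : 0 ≤ a) (haD : a ≤ 2 * D)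
    (hc : c + a ≤ ∑ i ∈ s, P.real (E i)) :
    P.real {ω | ∑ i ∈ s, (E i).indicator (1 : Ω → ℝ) ω ≤ c} ≤ Real.exp (-(a ^ 2 / (4 * D))) := by
  have ht0 : 0 ≤ a / (2 * D) := by positivity
  have ht1 : |-(a / (2 * D))| ≤ 1 := by
    rw [abs_neg, abs_of_nonneg ht0, div_le_one (by positivity)]
    exact haD
  have h1 := measure_le_le_exp_mul_mgf c (neg_nonpos.2 ht0)
    (integrable_exp_sum_indicator (P := P) hE s _)
  simp only [Finset.sum_apply] at h1
  refine h1.trans ((mul_le_mul_of_nonneg_left (mgf_sum_indicator_le hE hind s ht1)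
    (Real.exp_pos _).le).trans ?_)
  rw [← Real.exp_add, Real.exp_le_exp]
  set t := a / (2 * D) with ht
  set μ := ∑ i ∈ s, P.real (E i)
  have e1 : a = 2 * D * t := by rw [ht]; field_simp
  have e2 : a ^ 2 / (4 * D) = D * t ^ 2 := by rw [e1]; field_simp; ring
  have h2 : t * (c + a) ≤ t * μ := mul_le_mul_of_nonneg_left hc ht0
  have h3 : μ * t ^ 2 ≤ D * t ^ 2 := mul_le_mul_of_nonneg_right hmean (sq_nonneg t)
  have h4 : t * a = 2 * (D * t ^ 2) := by rw [e1]; ring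
  rw [e2]
  linarith

end chernoff

/-! ### Bounds for the LRU hit probability -/

theorem pastWindow_mono {s t : EReal} (h : s ≤ t) : pastWindow s ⊆ pastWindow t :=
  fun _ hx => ⟨(EReal.neg_le_neg_iff.2 h).trans hx.1, hx.2⟩

theorem requested_mono (μ : Measure ℝ) {s t : EReal} (h : s ≤ t) :
    requested μ s ≤ requested μ t := by
  unfold requested
  split_ifs with h1 h2
  · exact le_rfl
  · exact absurd (fun h0 => h1 (measure_mono_null (pastWindow_mono h) h0)) h2
  · exact zero_le_one
  · exact le_rfl

theorem requested_le_one (μ : Measure ℝ) (t : EReal) : requested μ t ≤ 1 := by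
  unfold requested
  split_ifs <;> simp

variable {n : ℕ} {N : Fin n → Ω → Measure ℝ} {i : Fin n}

theorem numRequested_mono (μ : Fin n → Measure ℝ) {s t : EReal} (h : s ≤ t) :
    numRequested μ s ≤ numRequested μ t :=
  Finset.sum_le_sum fun j _ => requested_mono (μ j) h

omit [MeasurableSpace Ω] in
theorem requested_shift (s t : ℝ) (j : Fin n) (ω : Ω) :
    (requested (shift s (N j ω)) (t : EReal) : ℝ) =
      {ω | N j ω (Ico (s - t) s) ≠ 0}.indicator 1 ω := by
  unfold requested
  rw [shift_pastWindow]
  split_ifs with h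
  · rw [indicator_of_mem (show ω ∈ {ω | N j ω (Ico (s - t) s) ≠ 0} from h)]
    simp
  · rw [indicator_of_notMem (show ω ∉ {ω | N j ω (Ico (s - t) s) ≠ 0} from h)]
    simp

omit [MeasurableSpace Ω] in
theorem indicator_hit_mono (j : Fin n) (ω : Ω) {a b c d : ℝ} (h : Ico a b ⊆ Ico c d) :
    {ω | N j ω (Ico a b) ≠ 0}.indicator (1 : Ω → ℝ) ω ≤
      {ω | N j ω (Ico c d) ≠ 0}.indicator 1 ω :=
  indicator_le_indicator_of_subset
    (ofPred_subset_ofPred.2 fun _ hω h0 => hω (measure_mono_null h h0))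
    (fun _ => zero_le_one) ω

omit [IsProbabilityMeasure P] in
/-- An event determined by the other processes is independent of the `i`-th process. -/
theorem indepFun_indicator_others (hN : ∀ j, IsRequestProcess P (N j)) (hind : iIndepFun N P)
    {B : Set (↥(Finset.univ.erase i) → Measure ℝ)} (hB : MeasurableSet B) :
    IndepFun (N i) ({ω | (fun j : ↥(Finset.univ.erase i) => N j ω) ∈ B}.indicator
      (1 : Ω → ℝ≥0∞)) P := by
  have h1 := hind.indepFun_finset {i} (Finset.univ.erase i) (by simp) fun j => (hN j).measurable
  have hφ : Measurable fun f : ↥({i} : Finset (Fin n)) → Measure ℝ =>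
      f ⟨i, Finset.mem_singleton_self i⟩ := measurable_pi_apply _
  have hψ : Measurable (B.indicator (1 : (↥(Finset.univ.erase i) → Measure ℝ) → ℝ≥0∞)) :=
    measurable_one.indicator hB
  exact h1.comp hφ hψ

/-- The number of contents other than `i` with a request in the window `W`. -/
noncomputable def othersHit (N : Fin n → Ω → Measure ℝ) (i : Fin n) (W : Set ℝ) (ω : Ω) : ℝ :=
  ∑ j ∈ Finset.univ.erase i, {ω | N j ω W ≠ 0}.indicator (1 : Ω → ℝ) ω

theorem measurable_sum_hit (W : Set ℝ) (hW : MeasurableSet W) :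
    Measurable fun g : ↥(Finset.univ.erase i) → Measure ℝ =>
      ∑ j, {μ : Measure ℝ | μ W ≠ 0}.indicator (1 : Measure ℝ → ℝ) (g j) := by
  have hmeas : Measurable ({μ : Measure ℝ | μ W ≠ 0}.indicator (1 : Measure ℝ → ℝ)) :=
    measurable_one.indicator (Measure.measurable_coe hW (measurableSet_singleton 0)).compl
  exact Finset.measurable_sum _ fun j _ => hmeas.comp (measurable_pi_apply j)

omit [MeasurableSpace Ω] in
theorem othersHit_eq (W : Set ℝ) (ω : Ω) : othersHit N i W ω =
    ∑ j : ↥(Finset.univ.erase i), {μ : Measure ℝ | μ W ≠ 0}.indicator (1 : Measure ℝ → ℝ) (N j ω) :=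
  (Finset.sum_coe_sort (Finset.univ.erase i)
    fun j => {μ : Measure ℝ | μ W ≠ 0}.indicator (1 : Measure ℝ → ℝ) (N j ω)).symm

omit [IsProbabilityMeasure P] in
theorem indepFun_othersHit (hN : ∀ j, IsRequestProcess P (N j)) (hind : iIndepFun N P)
    {W : Set ℝ} (hW : MeasurableSet W) {S : Set ℝ} (hS : MeasurableSet S) :
    MeasurableSet {ω | othersHit N i W ω ∈ S} ∧
      IndepFun (N i) ({ω | othersHit N i W ω ∈ S}.indicator (1 : Ω → ℝ≥0∞)) P := by
  have hB : MeasurableSet {g : ↥(Finset.univ.erase i) → Measure ℝ |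
      ∑ j, {μ : Measure ℝ | μ W ≠ 0}.indicator (1 : Measure ℝ → ℝ) (g j) ∈ S} :=
    measurable_sum_hit W hW hS
  have heq : {ω | othersHit N i W ω ∈ S} = {ω | (fun j : ↥(Finset.univ.erase i) => N j ω) ∈
      {g : ↥(Finset.univ.erase i) → Measure ℝ |
        ∑ j, {μ : Measure ℝ | μ W ≠ 0}.indicator (1 : Measure ℝ → ℝ) (g j) ∈ S}} := by
    ext ω
    simp only [mem_ofPred_eq, othersHit_eq]
  rw [heq]
  exact ⟨measurableSet_preimage (measurable_pi_lambda _ fun j => (hN j).measurable) hB,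
    indepFun_indicator_others hN hind hB⟩

omit [IsProbabilityMeasure P] in
theorem iIndepFun_hit (hind : iIndepFun N P) {W : Set ℝ} (hW : MeasurableSet W) :
    iIndepFun (fun j => {ω | N j ω W ≠ 0}.indicator (1 : Ω → ℝ)) P :=
  hind.comp (fun _ => {μ : Measure ℝ | μ W ≠ 0}.indicator (1 : Measure ℝ → ℝ)) fun _ =>
    measurable_one.indicator (Measure.measurable_coe hW (measurableSet_singleton 0)).compl

omit [IsProbabilityMeasure P] in
theorem sum_erase_prob_Ico (hN : ∀ j, IsRequestProcess P (N j)) (r t : ℝ) :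
    ∑ j ∈ Finset.univ.erase i, P.real {ω | N j ω (Ico (r - t) r) ≠ 0} =
      ∑ j, hitProb P (N j) t - hitProb P (N i) t := by
  rw [← Finset.sum_erase_add _ _ (Finset.mem_univ i), add_sub_cancel_right]
  refine Finset.sum_congr rfl fun j _ => ?_
  rw [(hN j).prob_Ico, sub_sub_cancel]

omit [IsProbabilityMeasure P] in
theorem hitProb_nonneg (N : Ω → Measure ℝ) (t : ℝ) : 0 ≤ hitProb P N t := measureReal_nonneg

theorem exists_grid {d : ℝ} (hd : 0 < d) : ∃ m : ℕ, 0 < m ∧ 2 * (1 / (m : ℝ)) ≤ d := by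
  obtain ⟨m, hm⟩ := exists_nat_one_div_lt (half_pos hd)
  refine ⟨m + 1, Nat.succ_pos m, ?_⟩
  push_cast
  linarith

/-- Upper bound for the LRU hit probability through a deviation bound on the eviction time. -/
theorem hitLRU_le (hN : ∀ j, IsRequestProcess P (N j)) (hind : iIndepFun N P) {a b c y D : ℝ}
    (ha : 0 < a) (hab : a < b) (hD : 0 < D) (hKD : ∑ j, hitProb P (N j) a ≤ D) (hy : 0 ≤ y)
    (hyD : y ≤ 2 * D) (hc : c + 1 + y ≤ ∑ j, hitProb P (N j) a) :
    hitLRU P N c i ≤ interCdf P N i b + Real.exp (-(y ^ 2 / (4 * D))) := by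
  -- Two mesh widths must fit between `a` and `b`: one for the position of `s` in its cell, one for
  -- turning the slope back into a value of `interCdf`.
  obtain ⟨m, hm, hmb⟩ := exists_grid (sub_pos.2 hab)
  have hm' : (0 : ℝ) < m := by exact_mod_cast hm
  have hm1 : 0 < 1 / (m : ℝ) := by positivity
  have hi0 := hitProb_nonneg (P := P) (N i) a
  have hi1 := hitProb_le_one (P := P) (N i) a
  have h1 := palmProb_le_one_sub_hitSlope (hN i) hm (t := a + 1 / m) (by positivity)
    {μ | requested (μ i) (evictionTime c μ) = 1}
    -- The window ends at the left end of the cell, so it does not depend on `s` and lies inside `[s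
    -- - (a + 1 / m), s)`. Off `V k` the other contents alone reach `c`, so eviction occurs by `a +
    -- 1 / m`. The `1` in `hc` covers the mean of the omitted content `i`.
    (V := fun k => {ω | othersHit N i (Ico ((k : ℝ) / m - a) (k / m)) ω ∈ Iic c})
    (v := Real.exp (-(y ^ 2 / (4 * D))))
    (fun k => (indepFun_othersHit hN hind measurableSet_Ico measurableSet_Iic).1)
    (fun k => (indepFun_othersHit hN hind measurableSet_Ico measurableSet_Iic).2)
    (fun k => by
      refine chernoff_lower (fun j => (hN j).measurableSet_ne measurableSet_Ico)
        (iIndepFun_hit hind measurableSet_Ico) _ hD ?_ hy hyD ?_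
      · rw [sum_erase_prob_Ico hN]; linarith
      · rw [sum_erase_prob_Ico hN]; linarith)
    (fun ω k s hs hA hV => by
      rw [mem_ofPred_eq, mem_Iic, not_le] at hV
      have hle : othersHit N i (Ico ((k : ℝ) / m - a) (k / m)) ω ≤
          (numRequested (fun j => shift s (N j ω)) ((a + 1 / m : ℝ) : EReal) : ℝ) := by
        rw [numRequested, Nat.cast_sum, othersHit]
        refine (Finset.sum_le_sum fun j _ => ?_).trans
          (Finset.sum_le_sum_of_subset_of_nonneg (Finset.subset_univ _) fun _ _ _ =>
            Nat.cast_nonneg _)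
        rw [requested_shift]
        refine indicator_hit_mono j ω (Ico_subset_Ico ?_ hs.1.le)
        linarith [hs.2]
      have hev : evictionTime c (fun j => shift s (N j ω)) ≤ ((a + 1 / m : ℝ) : EReal) :=
        sInf_le (hV.le.trans hle)
      rw [mem_ofPred_eq, requested_eq_one_iff] at hA
      rw [← shift_pastWindow]
      exact fun h0 => hA (measure_mono_null (pastWindow_mono hev) h0))
  have h2 := one_sub_hitSlope_le_interCdf (hN i) hm (t := a + 1 / m) (by positivity)
  have h3 := interCdf_mono (hN i) (show a + 1 / m + 1 / m ≤ b by linarith)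
  rw [hitLRU]
  linarith

/-- Lower bound for the LRU hit probability through a deviation bound on the eviction time. -/
theorem le_hitLRU (hN : ∀ j, IsRequestProcess P (N j)) (hind : iIndepFun N P) {a b c y D : ℝ}
    (ha : 0 < a) (hab : a < b) (hD : 0 < D) (hKD : ∑ j, hitProb P (N j) b ≤ D) (hy : 0 ≤ y)
    (hyD : y ≤ 2 * D) (hc : ∑ j, hitProb P (N j) b + 1 + y ≤ c) :
    interCdf P N i a - Real.exp (-(y ^ 2 / (4 * D))) ≤ hitLRU P N c i := by
  obtain ⟨m, hm, hmb⟩ := exists_grid (sub_pos.2 hab)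
  have hm' : (0 : ℝ) < m := by exact_mod_cast hm
  have hm1 : 0 < 1 / (m : ℝ) := by positivity
  have hi0 := hitProb_nonneg (P := P) (N i) b
  have h1 := one_sub_hitSlope_le_palmProb (hN i) hm ha.le
    {μ | requested (μ i) (evictionTime c μ) = 1}
    -- Now the window ends at the right end of the cell and contains `[s - (a + 1 / m), s)`. The
    -- threshold is `c - 1` because content `i` adds at most one.
    (V := fun k => {ω | othersHit N i (Ico ((k : ℝ) / m + 1 / m - b) (k / m + 1 / m)) ω ∈
      Ici (c - 1)})
    (v := Real.exp (-(y ^ 2 / (4 * D))))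
    (fun k => (indepFun_othersHit hN hind measurableSet_Ico measurableSet_Ici).1)
    (fun k => (indepFun_othersHit hN hind measurableSet_Ico measurableSet_Ici).2)
    (fun k => by
      refine chernoff_upper (fun j => (hN j).measurableSet_ne measurableSet_Ico)
        (iIndepFun_hit hind measurableSet_Ico) _ hD ?_ hy hyD ?_
      · rw [sum_erase_prob_Ico hN]; linarith
      · rw [sum_erase_prob_Ico hN]; linarith)
    (fun ω k s hs hA hV => by
      rw [mem_ofPred_eq, mem_Ici, not_le] at hV
      have hle : (numRequested (fun j => shift s (N j ω)) ((a + 1 / m : ℝ) : EReal) : ℝ) ≤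
          othersHit N i (Ico ((k : ℝ) / m + 1 / m - b) (k / m + 1 / m)) ω + 1 := by
        rw [numRequested, Nat.cast_sum, ← Finset.sum_erase_add _ _ (Finset.mem_univ i), othersHit]
        refine add_le_add (Finset.sum_le_sum fun j _ => ?_)
          (by exact_mod_cast requested_le_one _ _)
        rw [requested_shift]
        refine indicator_hit_mono j ω (Ico_subset_Ico ?_ hs.2)
        linarith [hs.1]
      have hev : ((a + 1 / m : ℝ) : EReal) ≤ evictionTime c (fun j => shift s (N j ω)) := by
        refine le_sInf fun t ht => ?_
        by_contra hlt
        rw [not_le] at hlt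
        have h4 : (numRequested (fun j => shift s (N j ω)) t : ℝ) ≤
            numRequested (fun j => shift s (N j ω)) ((a + 1 / m : ℝ) : EReal) := by
          exact_mod_cast numRequested_mono _ hlt.le
        have h5 : c ≤ (numRequested (fun j => shift s (N j ω)) t : ℝ) := ht
        linarith
      rw [mem_ofPred_eq, requested_eq_one_iff]
      rw [← shift_pastWindow] at hA
      exact fun h0 => hA (measure_mono_null (pastWindow_mono hev) h0))
  have h2 := interCdf_le_one_sub_hitSlope (hN i) hm ha.le
  rw [hitLRU]
  linarith

/-! ### The characteristic time -/

theorem expectedContents_eq (hN : ∀ j, IsRequestProcess P (N j)) (t : ℝ) :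
    expectedContents P N t = ∑ j, hitProb P (N j) t := by
  have h1 : ∀ (j : Fin n) (ω : Ω), (requested (N j ω) (t : EReal) : ℝ) =
      {ω | N j ω (Ico (-t) 0) ≠ 0}.indicator 1 ω := by
    intro j ω
    unfold requested
    rw [pastWindow_coe]
    split_ifs with h
    · rw [indicator_of_mem (show ω ∈ {ω | N j ω (Ico (-t) 0) ≠ 0} from h)]
      simp
    · rw [indicator_of_notMem (show ω ∉ {ω | N j ω (Ico (-t) 0) ≠ 0} from h)]
      simp
  have hm : ∀ j, MeasurableSet {ω | N j ω (Ico (-t) 0) ≠ 0} :=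
    fun j => (hN j).measurableSet_ne measurableSet_Ico
  simp only [expectedContents, numRequested, Nat.cast_sum, h1]
  have hint : ∀ j, Integrable ({ω | N j ω (Ico (-t) 0) ≠ 0}.indicator (1 : Ω → ℝ)) P :=
    fun j => (integrable_const (1 : ℝ)).indicator (hm j)
  rw [integral_finsetSum _ fun j _ => hint j]
  exact Finset.sum_congr rfl fun j _ => integral_indicator_one (hm j)

/-- The characteristic time exists for every cache size smaller than the catalogue. -/
theorem exists_isCharTime (hN : ∀ j, IsRequestProcess P (N j))
    (hG : ∀ j, Continuous (interCdf P N j)) {c : ℝ} (hc0 : 0 < c) (hcn : c < n) :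
    ∃ t, IsCharTime P N c t := by
  have hlim : Tendsto (fun k : ℕ => ∑ j, hitProb P (N j) (2 * k)) atTop (𝓝 (∑ _j : Fin n, 1)) :=
    tendsto_finsetSum _ fun j _ => (hN j).tendsto_hitProb
  have hn : (∑ _j : Fin n, (1 : ℝ)) = n := by simp
  rw [hn] at hlim
  obtain ⟨k, hk⟩ := (hlim.eventually_const_lt hcn).exists
  have hcont : ContinuousOn (fun t => ∑ j, hitProb P (N j) t) (Icc 0 (2 * k)) :=
    continuousOn_finsetSum _ fun j _ =>
      (isHitProfile (hN j) (hG j)).continuousOn.mono Icc_subset_Ici_self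
  have h0 : ∑ j, hitProb P (N j) 0 = 0 := by simp [hitProb_zero]
  obtain ⟨t, ht, hct⟩ := intermediate_value_Icc (by positivity) hcont
    (show c ∈ Icc _ _ from ⟨by rw [h0]; exact hc0.le, hk.le⟩)
  exact ⟨t, ht.1, by rw [expectedContents_eq hN]; exact hct⟩

end lru

/-! ### Tail sums of ordered families -/

section tail
variable {n : ℕ} {p : Fin n → ℝ}

theorem sort_antitone (p : Fin n → ℝ) {j k : Fin n} (h : j ≤ k) :
    p (Tuple.sort (fun i => -p i) k) ≤ p (Tuple.sort (fun i => -p i) j) :=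
  neg_le_neg_iff.1 (Tuple.monotone_sort (fun i => -p i) h)

/-- If at most `k` entries are at least `a`, the tail sum is at most the sum of the entries
below `a`. -/
theorem tailSum_le_sum_filter (hp : ∀ i, 0 ≤ p i) (a : ℝ) {k : ℕ}
    (hk : (Finset.univ.filter fun i => a ≤ p i).card ≤ k) :
    tailSum p k ≤ ∑ i with p i < a, p i := by
  set σ := Tuple.sort (fun i => -p i)
  rw [Finset.sum_filter, ← Equiv.sum_comp σ, tailSum]
  refine Finset.sum_le_sum fun j _ => ?_
  by_cases hkj : k ≤ (j : ℕ)
  · have hlt : p (σ j) < a := by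
      by_contra hle
      rw [not_lt] at hle
      -- If the entry at position `j ≥ k` were at least `a`, so would be all `j + 1 > k` entries up
      -- to it.
      have hsub : (Finset.Iic j).map σ.toEmbedding ⊆ Finset.univ.filter fun i => a ≤ p i := by
        intro x hx
        obtain ⟨l, hl, rfl⟩ := Finset.mem_map.1 hx
        simpa using hle.trans (sort_antitone p (Finset.mem_Iic.1 hl))
      have hcard := Finset.card_le_card hsub
      rw [Finset.card_map, Fin.card_Iic] at hcard
      omega
    simp [hkj, hlt, σ]
  · rw [if_neg hkj]
    split_ifs
    · exact hp _
    · exact le_rfl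

/-- A sum of terms that are at most one and at most `b p` is at most `k` plus `b` times the
tail sum. -/
theorem sum_le_add_mul_tailSum {f : Fin n → ℝ} {b : ℝ} (hf1 : ∀ i, f i ≤ 1)
    (hf : ∀ i, f i ≤ b * p i) (k : ℕ) : ∑ i, f i ≤ k + b * tailSum p k := by
  set σ := Tuple.sort (fun i => -p i)
  have h1 : ∀ j : Fin n, f (σ j) ≤
      (if (j : ℕ) < k then 1 else 0) + b * (if k ≤ (j : ℕ) then p (σ j) else 0) := by
    intro j
    by_cases hkj : k ≤ (j : ℕ)
    · simpa [hkj, not_lt.2 hkj] using hf (σ j)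
    · simpa [hkj, not_le.1 hkj] using hf1 (σ j)
  have h2 : (∑ j : Fin n, if (j : ℕ) < k then (1 : ℝ) else 0) ≤ k := by
    rw [Finset.sum_boole]
    have : (Finset.univ.filter fun j : Fin n => (j : ℕ) < k).card ≤ (Finset.range k).card :=
      Finset.card_le_card_of_injOn (fun j => (j : ℕ)) (fun j hj => by simpa using hj)
        (fun _ _ _ _ h => Fin.ext h)
    rw [Finset.card_range] at this
    exact_mod_cast this
  rw [← Equiv.sum_comp σ, tailSum, Finset.mul_sum]
  refine (Finset.sum_le_sum fun j _ => h1 j).trans ?_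
  rw [Finset.sum_add_distrib]
  linarith

end tail

/-! ### Growth of the expected number of contents -/

section growth
variable {n : ℕ} {r : Fin n → ℝ} {G F : Fin n → ℝ → ℝ}

/-- The substitution `u = r * s` turns domination of the standardised tail into a lower bound that
depends on the rate only through `r * T`. -/
theorem integral_dominating_le {r : ℝ} {G F Ψ : ℝ → ℝ} (h : IsHitProfile r G F)
    (hΨ : Continuous Ψ) (hdom : ∀ t, 0 ≤ t → 1 - Ψ (r * t) ≤ 1 - G t) {T : ℝ} (hT : 0 ≤ T) :
    ∫ s in (0 : ℝ)..r * T, (1 - Ψ s) ≤ F T := by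
  have h1 := intervalIntegral.integral_comp_mul_left (a := 0) (b := T) (fun s => 1 - Ψ s)
    h.rate_pos.ne'
  rw [mul_zero, smul_eq_mul, eq_inv_mul_iff_mul_eq₀ h.rate_pos.ne'] at h1
  rw [← h1, h.hit_eq T hT]
  refine mul_le_mul_of_nonneg_left ?_ h.rate_pos.le
  refine intervalIntegral.integral_mono_on hT ?_ ?_ fun s hs => hdom s hs.1
  · exact (continuous_const.sub (hΨ.comp (continuous_const.mul continuous_id))).intervalIntegrable
      _ _
  · exact (continuous_const.sub h.cont).intervalIntegrable _ _

/-- Lower bound for the derivative of the expected number of contents near the characteristic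
time. -/
theorem growth_lower_bound (h : ∀ j, IsHitProfile (r j) (G j) (F j)) {Ψ : ℝ → ℝ}
    (hΨ : Continuous Ψ) (hΨmono : Monotone Ψ) (hΨ1 : ∀ t, Ψ t ≤ 1)
    (hdom : ∀ j t, 0 ≤ t → 1 - Ψ (r j * t) ≤ 1 - G j t) {T c : ℝ} (hT : 0 < T) (hc : 0 < c)
    (hKT : ∑ j, F j T = c) {κ₁ κ₂ γ L L' : ℝ} (hκ₁ : 0 < κ₁) (hκ₂ : 0 ≤ κ₂) (hγ : 0 < γ)
    (hL : 0 < L) (hHL : 1 / κ₁ < ∫ s in (0 : ℝ)..L, (1 - Ψ s))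
    (hP : tailSum (fun j => r j / ∑ l, r l) ⌈κ₁ * c⌉₊ >
      γ * tailSum (fun j => r j / ∑ l, r l) ⌊κ₂ * c⌋₊)
    {x : ℝ} (hx : 0 ≤ x) (hxL : x * L ≤ L' * T) :
    (1 - Ψ L') * γ * (1 - κ₂) * c ≤ T * ∑ j, r j * (1 - G j x) := by
  set Λ := ∑ l, r l with hΛ
  set p : Fin n → ℝ := fun j => r j / Λ with hp
  have hn : (Finset.univ : Finset (Fin n)).Nonempty := by
    by_contra hne
    rw [Finset.not_nonempty_iff_eq_empty] at hne
    rw [hne, Finset.sum_empty] at hKT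
    exact hc.ne hKT
  have hΛpos : 0 < Λ := Finset.sum_pos (fun j _ => (h j).rate_pos) hn
  have hp0 : ∀ j, 0 ≤ p j := fun j => div_nonneg (h j).rate_pos.le hΛpos.le
  have hrp : ∀ j, r j = Λ * p j := fun j => by rw [hp]; field_simp
  -- The popular contents, those with `L ≤ r j * T`. Each contributes more than `1 / κ₁` to a sum
  -- equal to `c`, so there are at most `κ₁ * c` of them.
  set S := Finset.univ.filter fun j => L / (Λ * T) ≤ p j with hS
  have hmemS : ∀ j, L / (Λ * T) ≤ p j ↔ L ≤ r j * T := fun j => by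
    rw [div_le_iff₀ (by positivity), hrp j]
    ring_nf
  have hcard : S.card ≤ ⌈κ₁ * c⌉₊ := by
    have h1 : (S.card : ℝ) * (1 / κ₁) ≤ c := by
      calc (S.card : ℝ) * (1 / κ₁) = ∑ _j ∈ S, 1 / κ₁ := by simp
        _ ≤ ∑ j ∈ S, F j T := by
            refine Finset.sum_le_sum fun j hj => ?_
            have hjS := (hmemS j).1 (Finset.mem_filter.1 hj).2
            refine hHL.le.trans (le_trans ?_ (integral_dominating_le (h j) hΨ (hdom j) hT.le))
            have hint : ∀ a b, IntervalIntegrable (fun s => 1 - Ψ s) volume a b :=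
              fun a b => (continuous_const.sub hΨ).intervalIntegrable _ _
            rw [← sub_nonneg, intervalIntegral.integral_interval_sub_left (hint _ _) (hint _ _)]
            exact intervalIntegral.integral_nonneg hjS fun s _ => sub_nonneg.2 (hΨ1 s)
        _ ≤ ∑ j, F j T := Finset.sum_le_sum_of_subset_of_nonneg (Finset.subset_univ _)
            fun j _ _ => (h j).hit_nonneg hT.le
        _ = c := hKT
    have h2 : (S.card : ℝ) ≤ κ₁ * c := by
      rw [mul_one_div, div_le_iff₀ hκ₁] at h1
      linarith
    exact_mod_cast h2.trans (Nat.le_ceil _)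
  have hA := tailSum_le_sum_filter hp0 (L / (Λ * T)) hcard
  -- Bound `F j T` by `1` for the `⌊κ₂ * c⌋₊` most popular contents and by `r j * T` for the others.
  have hB : c ≤ (⌊κ₂ * c⌋₊ : ℝ) + T * Λ * tailSum p ⌊κ₂ * c⌋₊ := by
    rw [← hKT]
    refine sum_le_add_mul_tailSum (fun j => (h j).hit_le_one T) (fun j => ?_) _
    refine ((h j).hit_le hT.le).trans (le_of_eq ?_)
    rw [hrp j]
    ring
  have hfl : (⌊κ₂ * c⌋₊ : ℝ) ≤ κ₂ * c := Nat.floor_le (by positivity)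
  have hη : 0 ≤ 1 - Ψ L' := sub_nonneg.2 (hΨ1 _)
  -- An unpopular content has `r j * x ≤ L'`, so its tail at `x` is still at least `1 - Ψ L'`;
  -- popular contents are dropped.
  have hterm : ∀ j, (if p j < L / (Λ * T) then (1 - Ψ L') * r j else 0) ≤ r j * (1 - G j x) := by
    intro j
    split_ifs with hj
    · rw [← not_le, hmemS, not_le] at hj
      rw [mul_comm]
      refine mul_le_mul_of_nonneg_left ?_ (h j).rate_pos.le
      refine le_trans ?_ (hdom j x hx)
      have : r j * x ≤ L' := by
        have h3 : r j * x * L ≤ L' * L := by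
          calc r j * x * L = r j * (x * L) := by ring
            _ ≤ r j * (L' * T) := mul_le_mul_of_nonneg_left hxL (h j).rate_pos.le
            _ = L' * (r j * T) := by ring
            _ ≤ L' * L := by
                refine mul_le_mul_of_nonneg_left hj.le ?_
                -- A negative `L'` would contradict `0 ≤ x * L ≤ L' * T`.
                by_contra hneg
                have := mul_neg_of_neg_of_pos (not_le.1 hneg) hT
                have := mul_nonneg hx hL.le
                linarith
        exact le_of_mul_le_mul_right h3 hL
      linarith [hΨmono this]
    · exact mul_nonneg (h j).rate_pos.le (sub_nonneg.2 ((h j).le_one x))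
  have hsum : (1 - Ψ L') * (Λ * ∑ j with p j < L / (Λ * T), p j) ≤ ∑ j, r j * (1 - G j x) := by
    refine le_trans (le_of_eq ?_) (Finset.sum_le_sum fun j _ => hterm j)
    rw [← Finset.sum_filter, Finset.mul_sum, Finset.mul_sum]
    exact Finset.sum_congr rfl fun j _ => by rw [← hrp]
  have hTΛ : 0 < T * Λ := mul_pos hT hΛpos
  calc (1 - Ψ L') * γ * (1 - κ₂) * c = (1 - Ψ L') * (γ * (c - κ₂ * c)) := by ring
    _ ≤ (1 - Ψ L') * (γ * (T * Λ * tailSum p ⌊κ₂ * c⌋₊)) := by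
        gcongr
        linarith
    _ = (1 - Ψ L') * (T * Λ * (γ * tailSum p ⌊κ₂ * c⌋₊)) := by ring
    _ ≤ (1 - Ψ L') * (T * Λ * ∑ j with p j < L / (Λ * T), p j) := by
        refine mul_le_mul_of_nonneg_left (mul_le_mul_of_nonneg_left ?_ hTΛ.le) hη
        exact hP.le.trans hA
    _ = T * ((1 - Ψ L') * (Λ * ∑ j with p j < L / (Λ * T), p j)) := by ring
    _ ≤ _ := mul_le_mul_of_nonneg_left hsum hT.le

theorem sum_mul_le_sub (h : ∀ j, IsHitProfile (r j) (G j) (F j)) {a b : ℝ} (ha : 0 ≤ a)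
    (hab : a ≤ b) : (b - a) * ∑ j, r j * (1 - G j b) ≤ ∑ j, F j b - ∑ j, F j a := by
  rw [← Finset.sum_sub_distrib, Finset.mul_sum]
  refine Finset.sum_le_sum fun j _ => (le_of_eq ?_).trans ((h j).le_sub ha hab)
  ring

/-- Modulus of continuity of the inter-request cdf that does not depend on the rate. -/
theorem IsHitProfile.sub_le_sqrt {r : ℝ} {G F : ℝ → ℝ} (h : IsHitProfile r G F) {M ε s t : ℝ}
    (hM : 0 ≤ M) (hLip : ∀ s t, s ≤ t → G t - G s ≤ M * (r * (t - s))) (hs : 0 < s) (hst : s ≤ t)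
    (hts : t - s ≤ ε * s) : G t - G s ≤ Real.sqrt (M * ε) := by
  have hy : 0 < r * s := mul_pos h.rate_pos hs
  have h0 : 0 ≤ G t - G s := sub_nonneg.2 (h.mono hst)
  have h1 : G t - G s ≤ M * ε * (r * s) := by
    refine (hLip s t hst).trans ?_
    have := mul_le_mul_of_nonneg_left hts (mul_nonneg hM h.rate_pos.le)
    linarith
  have h2 : (r * s) * (G t - G s) ≤ 1 := by
    refine le_trans ?_ (h.mul_one_sub_le hs.le)
    exact mul_le_mul_of_nonneg_left (by linarith [h.le_one t]) hy.le
  refine Real.le_sqrt_of_sq_le ?_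
  have hMε : 0 ≤ M * ε := by
    by_contra hneg
    have := mul_neg_of_neg_of_pos (not_le.1 hneg) hy
    linarith
  -- The Lipschitz bound grows like `r * s` and the Markov bound decays like its inverse; in the
  -- product the rate cancels.
  calc (G t - G s) ^ 2 = (G t - G s) * (G t - G s) := sq _
    _ ≤ M * ε * (r * s) * (G t - G s) := mul_le_mul_of_nonneg_right h1 h0
    _ = M * ε * (r * s * (G t - G s)) := by ring
    _ ≤ M * ε := mul_le_of_le_one_right hMε h2

end growth

/-! ### The dominating distribution -/

/-- The integral of the tail increases continuously from `0` to the mean, so it takes two values `u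
< v` strictly between `q` and `m`, at `L < L'`. The strict inequality `L < L'` later leaves room to
go past the characteristic time by the factor `L' / L`. -/
theorem exists_truncation_levels (ψ : Measure ℝ) [IsProbabilityMeasure ψ] {m : ℝ}
    (hcont : Continuous (cdf ψ)) (hsupp : ψ (Iio 0) = 0) (hm : m = ∫ x, x ∂ψ) (hm0 : 0 < m)
    {q : ℝ} (hq0 : 0 ≤ q) (hqm : q < m) :
    ∃ L L' : ℝ, 0 < L ∧ L < L' ∧ q < ∫ s in (0 : ℝ)..L, (1 - cdf ψ s) ∧ cdf ψ L' < 1 := by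
  set H : ℝ → ℝ := fun x => ∫ s in (0 : ℝ)..x, (1 - cdf ψ s) with hH
  have hint : ∀ a b, IntervalIntegrable (fun s => 1 - cdf ψ s) volume a b :=
    fun a b => (continuous_const.sub hcont).intervalIntegrable _ _
  have hHcont : Continuous H := intervalIntegral.continuous_primitive hint 0
  have hH0 : H 0 = 0 := by simp [hH]
  -- The integral of a non-integrable function is `0` by convention, so `0 < m` forces
  -- integrability.
  have hψint : Integrable (fun x : ℝ => x) ψ := by
    by_contra hn
    rw [integral_undef hn] at hm
    exact hm0.ne' hm
  have hpos : 0 ≤ᵐ[ψ] fun x : ℝ => x := by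
    have : ∀ᵐ x ∂ψ, x ∉ Iio (0 : ℝ) := measure_eq_zero_iff_ae_notMem.1 hsupp
    filter_upwards [this] with x hx
    exact not_lt.1 hx
  have htail : m = ∫ t in Ioi (0 : ℝ), (1 - cdf ψ t) := by
    rw [hm, hψint.integral_eq_integral_meas_lt hpos]
    refine integral_congr_ae (ae_of_all _ fun t => ?_)
    change ψ.real (Ioi t) = 1 - cdf ψ t
    rw [cdf_eq_real, ← compl_Iic, probReal_compl_eq_one_sub measurableSet_Iic]
  have hIoi : IntegrableOn (fun t => 1 - cdf ψ t) (Ioi 0) := by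
    by_contra hn
    rw [integral_undef hn] at htail
    exact hm0.ne' htail
  have hlim : Tendsto H atTop (𝓝 m) := by
    rw [htail]
    exact intervalIntegral_tendsto_integral_Ioi 0 hIoi tendsto_id
  obtain ⟨u, hu1, hu2⟩ := exists_between hqm
  obtain ⟨v, hv1, hv2⟩ := exists_between hu2
  obtain ⟨X, hX, hX0⟩ := ((hlim.eventually_const_lt hv2).and (eventually_ge_atTop 0)).exists
  obtain ⟨L', hL', hHL'⟩ := intermediate_value_Icc hX0 hHcont.continuousOn
    (show v ∈ Icc _ _ from ⟨by rw [hH0]; linarith, hX.le⟩)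
  obtain ⟨L, hL, hHL⟩ := intermediate_value_Icc hL'.1 hHcont.continuousOn
    (show u ∈ Icc _ _ from ⟨by rw [hH0]; linarith, by rw [hHL']; exact hv1.le⟩)
  refine ⟨L, L', lt_of_le_of_ne hL.1 ?_, lt_of_le_of_ne hL.2 ?_, ?_, ?_⟩
  · rintro rfl
    rw [hH0] at hHL
    linarith
  · rintro rfl
    linarith
  · exact hu1.trans_eq hHL.symm
  -- With no tail left at `L'`, the function `H` could not rise above `v`, although its limit `m`
  -- exceeds `v`.
  · by_contra hge
    rw [not_lt] at hge
    have hle : ∀ᶠ x in atTop, H x ≤ v := by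
      filter_upwards [eventually_ge_atTop L'] with x hx
      have h1 := (integral_one_sub_bounds (monotone_cdf ψ) hcont hx).2
      have h2 : H x - H L' = ∫ s in L'..x, (1 - cdf ψ s) :=
        intervalIntegral.integral_interval_sub_left (hint _ _) (hint _ _)
      have h3 : (x - L') * (1 - cdf ψ L') ≤ 0 :=
        mul_nonpos_of_nonneg_of_nonpos (sub_nonneg.2 hx) (by linarith)
      linarith
    exact absurd (le_of_tendsto hlim hle) (not_le.2 hv2)

/-! ### The comparison of the two caches -/

section compare
variable {Ω : Type*} [MeasurableSpace Ω] {P : Measure Ω} [IsProbabilityMeasure P]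
  {n : ℕ} {N : Fin n → Ω → Measure ℝ}

theorem IsCharTime.pos (hN : ∀ j, IsRequestProcess P (N j)) {c T : ℝ} (hc : 0 < c)
    (hT : IsCharTime P N c T) : 0 < T := by
  refine lt_of_le_of_ne hT.1 ?_
  rintro rfl
  have h := hT.2
  rw [expectedContents_eq hN] at h
  simp only [hitProb_zero, Finset.sum_const_zero] at h
  exact hc.ne h

/-- The mean number of contents has positive slope just after a solution, so it exceeds `c` there
and by monotonicity never returns. -/
theorem IsCharTime.eq_of_growth (hN : ∀ j, IsRequestProcess P (N j))
    (hG : ∀ j, Continuous (interCdf P N j)) {c g l : ℝ} (hc : 0 < c) (hg : 0 < g) (hl : 1 < l)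
    (hgrowth : ∀ T, IsCharTime P N c T → ∀ x, 0 ≤ x → x ≤ l * T →
      g * c ≤ T * ∑ j, rate P N j * (1 - interCdf P N j x))
    {s t : ℝ} (hs : IsCharTime P N c s) (ht : IsCharTime P N c t) : s = t := by
  have key : ∀ {s t : ℝ}, IsCharTime P N c s → IsCharTime P N c t → ¬ s < t := by
    intro s t hs ht hst
    have hprof := fun j => isHitProfile (hN j) (hG j)
    have hs0 := hs.pos hN hc
    -- The growth bound is only available up to `l * s`.
    set x := min t (l * s) with hx
    have hsx : s < x := lt_min hst (by nlinarith)
    have h1 := hgrowth s hs x (hs0.trans hsx).le (min_le_right _ _)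
    have h2 := sum_mul_le_sub hprof hs0.le hsx.le
    have h3 : ∑ j, hitProb P (N j) x ≤ ∑ j, hitProb P (N j) t :=
      Finset.sum_le_sum fun j _ => hitProb_mono (min_le_left _ _)
    have e1 := hs.2
    have e2 := ht.2
    rw [expectedContents_eq hN] at e1 e2
    have h4 : 0 < ∑ j, rate P N j * (1 - interCdf P N j x) :=
      pos_of_mul_pos_right ((mul_pos hg hc).trans_le h1) hs0.le
    have h5 := mul_pos (sub_pos.2 hsx) h4
    linarith
  exact le_antisymm (not_lt.1 (key ht hs)) (not_lt.1 (key hs ht))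

/-- Quantitative comparison of the LRU and TTL hit probabilities. -/
theorem abs_hitLRU_sub_hitTTL_le (hN : ∀ j, IsRequestProcess P (N j)) (hind : iIndepFun N P)
    (hG : ∀ j, Continuous (interCdf P N j)) {M : ℝ≥0}
    (hLip : ∀ j, LipschitzWith M (interCdfStd P N j)) {c g δ T : ℝ} (hc : 0 < c)
    (hT : IsCharTime P N c T) (hg1 : g ≤ 1) (hδ : 0 < δ) (hδ1 : δ ≤ 1 / 4)
    (hgrowth : ∀ x, 0 ≤ x → x ≤ (1 + δ) * T →
      g * c ≤ T * ∑ j, rate P N j * (1 - interCdf P N j x))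
    (hbig : 2 ≤ δ * (g * c)) (i : Fin n) :
    |hitLRU P N c i - hitTTL P N T i| ≤
      Real.sqrt (M * (4 * δ)) + Real.exp (-((δ * (g * c) / 2) ^ 2 / (8 * c))) := by
  have hprof := fun j => isHitProfile (hN j) (hG j)
  have hT0 := hT.pos hN hc
  have hKT := hT.2
  rw [expectedContents_eq hN] at hKT
  have hδT : 0 < δ * T := mul_pos hδ hT0
  have hδT1 : δ * T ≤ 1 / 4 * T := mul_le_mul_of_nonneg_right hδ1 hT0.le
  have hgc : δ * (g * c) ≤ c := by
    have : g * c ≤ c := mul_le_of_le_one_left hc.le hg1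
    nlinarith
  have hy : 0 ≤ δ * (g * c) / 2 := by linarith
  have hLip' : ∀ s t, s ≤ t → interCdf P N i t - interCdf P N i s ≤
      M * (rate P N i * (t - s)) := by
    intro s t hst
    have hR := (hprof i).rate_pos
    have h1 := (hLip i).dist_le_mul (rate P N i * t) (rate P N i * s)
    rw [interCdfStd, interCdfStd, mul_div_cancel_left₀ _ hR.ne', mul_div_cancel_left₀ _ hR.ne',
      Real.dist_eq, Real.dist_eq, ← mul_sub,
      abs_of_nonneg (mul_nonneg hR.le (sub_nonneg.2 hst))] at h1
    exact (le_abs_self _).trans h1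
  rw [hitTTL_eq_interCdf (hN i) (hG i) hT0, abs_sub_le_iff]
  rw [show 8 * c = 4 * (2 * c) by ring]
  constructor
  · have h1 := sum_mul_le_sub hprof hT0.le (show T ≤ (1 + δ) * T by linarith)
    have h2 := hgrowth ((1 + δ) * T) (by positivity) le_rfl
    have h3 : (1 + δ) * T - T = δ * T := by ring
    rw [h3, hKT, mul_assoc] at h1
    have h4 : δ * (g * c) ≤ ∑ j, hitProb P (N j) ((1 + δ) * T) - c :=
      (mul_le_mul_of_nonneg_left h2 hδ.le).trans h1
    -- Here `(1 + δ) * T ≤ 2 * T`, and doubling the window at most doubles the mean, so `D = 2 * c`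
    -- serves.
    have hD : ∑ j, hitProb P (N j) ((1 + δ) * T) ≤ 2 * c := by
      rw [← hKT, Finset.mul_sum]
      exact Finset.sum_le_sum fun j _ =>
        (hitProb_mono (by linarith)).trans ((hprof j).hit_two_mul_le hT0.le)
    -- The margin `δ * (g * c)` is split in half: one half is the deviation `y`, the other is at
    -- least `1` by `hbig` and absorbs content `i`.
    have h5 := hitLRU_le (i := i) hN hind (a := (1 + δ) * T) (b := (1 + 2 * δ) * T) (c := c)
      (y := δ * (g * c) / 2) (D := 2 * c) (by positivity) (by linarith) (by positivity) hD hy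
      (by linarith) (by linarith)
    have h6 := (hprof i).sub_le_sqrt (ε := 4 * δ) (s := T) (t := (1 + 2 * δ) * T) M.coe_nonneg hLip' hT0
      (by linarith) (by linarith)
    linarith
  · have h1 := sum_mul_le_sub hprof (show 0 ≤ (1 - δ) * T by linarith)
      (show (1 - δ) * T ≤ T by linarith)
    have h2 := hgrowth T hT0.le (by linarith)
    have h3 : T - (1 - δ) * T = δ * T := by ring
    rw [h3, hKT, mul_assoc] at h1
    have h4 : δ * (g * c) ≤ c - ∑ j, hitProb P (N j) ((1 - δ) * T) :=
      (mul_le_mul_of_nonneg_left h2 hδ.le).trans h1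
    have h5 := le_hitLRU (i := i) hN hind (a := (1 - 2 * δ) * T) (b := (1 - δ) * T) (c := c)
      (y := δ * (g * c) / 2) (D := 2 * c) (by linarith) (by linarith) (by positivity)
      (by linarith) hy (by linarith) (by linarith)
    -- The gap `2 * δ * T` is at most `4 * δ` times the left endpoint because `δ ≤ 1 / 4`; this
    -- fixes the constant `4`.
    have h6 := (hprof i).sub_le_sqrt (ε := 4 * δ) (s := (1 - 2 * δ) * T) (t := T) M.coe_nonneg hLip'
      (by linarith) (by linarith) (by nlinarith)
    linarith

end compare

/-! ### Asymptotics of the error bound -/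

/-- The factor `6 / g` makes the deviation `δ * (g * c) / 2` equal to `3 * sqrt (c * log c)`, so the
exponent is `9 / 8 * log c` and the Chernoff term is at most `1 / c`. The square root term then
dictates the rate. -/
theorem error_bound {c g δ M : ℝ} (hM : 0 ≤ M) (hg : 0 < g) (hlog : 1 ≤ Real.log c) (hc : 1 ≤ c)
    (hδ : δ = 6 / g * Real.sqrt (Real.log c / c)) :
    2 ≤ δ * (g * c) ∧
    Real.sqrt (M * (4 * δ)) + Real.exp (-((δ * (g * c) / 2) ^ 2 / (8 * c))) ≤
      (Real.sqrt (M * (24 / g)) + 1) * (Real.log c / c) ^ (1 / 4 : ℝ) := by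
  have hc0 : 0 < c := by linarith
  set ρ := Real.log c / c with hρ
  have hρ0 : 0 < ρ := by positivity
  have hρ1 : ρ ≤ 1 := by
    rw [hρ, div_le_one hc0]
    linarith [Real.log_le_sub_one_of_pos hc0]
  have hρc : ρ * c = Real.log c := by rw [hρ]; field_simp
  have e1 : δ * (g * c) = 6 * (Real.sqrt ρ * c) := by rw [hδ]; field_simp
  have hsq : (Real.sqrt ρ * c) ^ 2 = Real.log c * c := by
    rw [mul_pow, Real.sq_sqrt hρ0.le, sq, ← mul_assoc, hρc]
  have h1 : 1 ≤ Real.sqrt ρ * c := by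
    rw [← one_le_sq_iff₀ (by positivity), hsq]
    nlinarith
  refine ⟨by rw [e1]; linarith, ?_⟩
  have hquarter : ρ ^ (1 / 4 : ℝ) = Real.sqrt (Real.sqrt ρ) := by
    rw [Real.sqrt_eq_rpow, Real.sqrt_eq_rpow, ← Real.rpow_mul hρ0.le]
    norm_num
  have h2 : Real.sqrt (M * (4 * δ)) = Real.sqrt (M * (24 / g)) * ρ ^ (1 / 4 : ℝ) := by
    rw [hquarter, ← Real.sqrt_mul (by positivity), hδ]
    congr 1
    ring
  have h3 : Real.exp (-((δ * (g * c) / 2) ^ 2 / (8 * c))) ≤ ρ ^ (1 / 4 : ℝ) := by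
    have e2 : (δ * (g * c) / 2) ^ 2 / (8 * c) = 9 / 8 * Real.log c := by
      rw [e1, show (6 * (Real.sqrt ρ * c) / 2) ^ 2 = 9 * (Real.sqrt ρ * c) ^ 2 by ring, hsq]
      field_simp
    calc Real.exp (-((δ * (g * c) / 2) ^ 2 / (8 * c))) ≤ Real.exp (-Real.log c) := by
          rw [e2, Real.exp_le_exp]
          linarith
      _ = 1 / c := by rw [Real.exp_neg, Real.exp_log hc0, one_div]
      _ ≤ ρ := by rw [hρ]; gcongr
      _ = ρ ^ (1 : ℝ) := (Real.rpow_one ρ).symm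
      _ ≤ ρ ^ (1 / 4 : ℝ) := Real.rpow_le_rpow_of_exponent_ge hρ0 hρ1 (by norm_num)
  rw [h2, add_mul, one_mul]
  linarith

theorem tendsto_sqrt_log_div {C : ℕ → ℝ} (hC : Tendsto C atTop atTop) (a : ℝ) :
    Tendsto (fun n => a * Real.sqrt (Real.log (C n) / C n)) atTop (𝓝 0) := by
  have h1 : Tendsto (fun n => Real.log (C n) / C n) atTop (𝓝 0) :=
    Real.isLittleO_log_id_atTop.tendsto_div_nhds_zero.comp hC
  have h2 := (Real.continuous_sqrt.tendsto 0).comp h1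
  rw [Real.sqrt_zero] at h2
  simpa using h2.const_mul a

end LRU

/-! ### The main theorem -/

theorem mainTheorem2 {Ω : Type*} [MeasurableSpace Ω] (P : Measure Ω) [IsProbabilityMeasure P]
    -- cache sizes and request processes: `n` contents in the `n`-th system
    (C : ℕ → ℝ) (N : (n : ℕ) → Fin n → Ω → Measure ℝ)
    (hC_range : ∀ᶠ n : ℕ in atTop, 0 < C n ∧ C n < n)
    (hC_lim : Tendsto C atTop atTop)
    (hN : ∀ n i, LRU.IsRequestProcess P (N n i))
    (hN_indep : ∀ n, iIndepFun (N n) P)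
    (hG_cont : ∀ n i, Continuous (LRU.interCdf P (N n) i))
    -- the cdf `Ψ` of `ψ` and its mean `m`
    (ψ : Measure ℝ) [IsProbabilityMeasure ψ] (m : ℝ)
    (hψ_cont : Continuous (cdf ψ)) (hψ_supp : ψ (Iio 0) = 0)
    (hm : m = ∫ x, x ∂ψ) (hm_pos : 0 < m)
    (hψ_dom : ∀ n i t, 1 - cdf ψ t ≤ 1 - LRU.interCdfStd P (N n) i t)
    -- (C1)
    (β₁ : ℝ) (hβ₁ : β₁ ∈ Ioo 0 m) (hC1 : ∀ᶠ n : ℕ in atTop, C n ≤ β₁ * n)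
    -- (R5)
    (hR5 : ∃ M : ℝ≥0, ∀ n i, LipschitzWith M (LRU.interCdfStd P (N n) i))
    -- (P1)
    (κ₁ κ₂ γ : ℝ) (hκ₁ : κ₁ ∈ Ioo (1 / m) (1 / β₁)) (hκ₂ : κ₂ ∈ Ico (0 : ℝ) 1)
    (hγ : γ ∈ Ioo (0 : ℝ) 1)
    (hP1 : ∀ᶠ n : ℕ in atTop,
      LRU.tailSum (LRU.popularity P (N n)) ⌈κ₁ * C n⌉₊ >
        γ * LRU.tailSum (LRU.popularity P (N n)) ⌊κ₂ * C n⌋₊) :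
    (∀ᶠ n : ℕ in atTop, ∃! t : ℝ, LRU.IsCharTime P (N n) (C n) t) ∧
    ∀ T : ℕ → ℝ, (∀ᶠ n : ℕ in atTop, LRU.IsCharTime P (N n) (C n) (T n)) →
      (fun n : ℕ => ⨆ i : Fin n, |LRU.hitLRU P (N n) (C n) i - LRU.hitTTL P (N n) (T n) i|)
        =O[atTop] (fun n : ℕ => (Real.log (C n) / C n) ^ (1 / 4 : ℝ)) := by
  obtain ⟨M, hM⟩ := hR5
  have hκ₁pos : 0 < κ₁ := (one_div_pos.2 hm_pos).trans hκ₁.1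
  -- The condition `1 / m < κ₁` says exactly that `1 / κ₁` is below the mean, as the choice of
  -- levels requires.
  obtain ⟨L, L', hL, hLL', hHL, hL'⟩ := LRU.exists_truncation_levels ψ hψ_cont hψ_supp hm hm_pos
    (q := 1 / κ₁) (one_div_pos.2 hκ₁pos).le ((one_div_lt hm_pos hκ₁pos).1 hκ₁.1)
  set g := (1 - cdf ψ L') * γ * (1 - κ₂) with hg
  have hη0 : 0 < 1 - cdf ψ L' := sub_pos.2 hL'
  have hη1 : 1 - cdf ψ L' ≤ 1 := by linarith [cdf_nonneg ψ L']
  have hκ0 : 0 < 1 - κ₂ := sub_pos.2 hκ₂.2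
  have hg0 : 0 < g := mul_pos (mul_pos hη0 hγ.1) hκ0
  have hg1 : g ≤ 1 := mul_le_one₀ (mul_le_one₀ hη1 hγ.1.le hγ.2.le) hκ0.le (by linarith [hκ₂.1])
  have hl : 1 < L' / L := (one_lt_div hL).2 hLL'
  have hgrowth : ∀ᶠ n : ℕ in atTop, ∀ T, LRU.IsCharTime P (N n) (C n) T →
      ∀ x, 0 ≤ x → x ≤ L' / L * T →
      g * C n ≤ T * ∑ j, LRU.rate P (N n) j * (1 - LRU.interCdf P (N n) j x) := by
    filter_upwards [hC_range, hP1] with n hCn hPn T hT x hx hxT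
    have hprof := fun j => LRU.isHitProfile (hN n j) (hG_cont n j)
    have hKT := hT.2
    rw [LRU.expectedContents_eq (hN n)] at hKT
    refine LRU.growth_lower_bound hprof hψ_cont (monotone_cdf ψ) (cdf_le_one ψ)
      (fun j t _ => ?_) (hT.pos (hN n) hCn.1) hCn.1 hKT hκ₁pos hκ₂.1 hγ.1 hL hHL hPn hx ?_
    · have h1 := hψ_dom n j (LRU.rate P (N n) j * t)
      rwa [LRU.interCdfStd, mul_div_cancel_left₀ _ (hprof j).rate_pos.ne'] at h1
    · rw [div_mul_eq_mul_div, le_div_iff₀ hL] at hxT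
      exact hxT
  refine ⟨?_, fun T hT => ?_⟩
  · filter_upwards [hC_range, hgrowth] with n hCn hgn
    obtain ⟨t, ht⟩ := LRU.exists_isCharTime (hN n) (hG_cont n) hCn.1 hCn.2
    exact ⟨t, ht, fun s hs =>
      hs.eq_of_growth (hN n) (hG_cont n) hCn.1 hg0 hl hgn ht⟩
  · have hδlim := LRU.tendsto_sqrt_log_div hC_lim (6 / g)
    refine IsBigO.of_bound (Real.sqrt (M * (24 / g)) + 1) ?_
    -- Since `δ` tends to zero, eventually `δ ≤ 1 / 4` and `1 + δ ≤ L' / L`; the latter puts `(1 +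
    -- δ) * T n` within reach of the growth bound.
    filter_upwards [hC_range, hgrowth, hT, hC_lim.eventually_ge_atTop 1,
      (Real.tendsto_log_atTop.comp hC_lim).eventually_ge_atTop 1,
      hδlim.eventually_le_const (show (0 : ℝ) < 1 / 4 by norm_num),
      hδlim.eventually_le_const (sub_pos.2 hl)] with n hCn hgn hTn hC1n hlog hδ1 hδ2
    have hlog' : 1 ≤ Real.log (C n) := hlog
    obtain ⟨hbig, herr⟩ := LRU.error_bound M.coe_nonneg hg0 hlog' hC1n rfl
    have hρ : 0 < Real.log (C n) / C n := div_pos (by linarith) hCn.1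
    have hδ0 : 0 < 6 / g * Real.sqrt (Real.log (C n) / C n) := by positivity
    rw [Real.norm_of_nonneg (Real.iSup_nonneg fun i => abs_nonneg _),
      Real.norm_of_nonneg (Real.rpow_nonneg hρ.le _)]
    refine Real.iSup_le (fun i => le_trans ?_ herr) (by positivity)
    refine LRU.abs_hitLRU_sub_hitTTL_le (hN n) (hN_indep n) (hG_cont n) (hM n) hCn.1 hTn hg1 hδ0
      hδ1 (fun x hx hxT => hgn (T n) hTn x hx (hxT.trans ?_)) hbig i
    exact mul_le_mul_of_nonneg_right (by linarith) hTn.1
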